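/- **Setting.** Let $\mathcal Y$ be a finite alphabet with standard basis $(e_y)$ of $\mathbb R^{\mathcal Y}$. A shuffle array consists of local randomizer laws $W_0^{(n)},W_1^{(n)}$ on $\mathcal Y$, nonempty dominant sets $D_0,D_1\subseteq\mathcal Y$, strictly positive probability vectors $p_b$ on $D_b$, rare intensities $\alpha_b(y)\ge 0$ for $y\notin D_b$, and a composition sequence $k_n\in\{0,\dots,n-1\}$ such that $W_b^{(n)}(y)=p_b(y)+O(1/n)$ for $y\in D_b$, $nW_b^{(n)}(y)\to\alpha_b(y)$ for $y\notin D_b$, and $k_n/n\to\pi$. It is *two-dominant disjoint* if $|D_0|=|D_1|=2$ and $D_0\cap D_1=\varnothing$, *interior* if $\pi\in(0,1)$, and *quantitative* if for some $C_0$ and all large $n$, for both $b$, $\sum_{y\in D_b}|W_b^{(n)}(y)-p_b(y)|+\sum_{y\notin D_b}|nW_b^{(n)}(y)-\alpha_b(y)|+|k_n/n-\pi|\le C_0/n$. Put $\mu_b=\sum_{y\in D_b}p_b(y)e_y$, $M=\mathrm{span}\{e_y-\mu_b: b\in\{0,1\},\,y\in D_b\}$, and let $\Pi_G,\Pi_J$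 be the orthogonal projections onto $M,M^\perp$. For a histogram $h$ put $\widehat h=h-(n-k_n)\mu_0-k_n\mu_1$, $G_n(h)=n^{-1/2}\Pi_G\widehat h$ and $Z_n(h)=\Pi_J\widehat h$. Let $T_{n,j}$ be the law of the histogram of $n$ independent messages, $n-j$ of them from $W_0^{(n)}$ and $j$ from $W_1^{(n)}$. Let $P_n$ and $Q_n$ be the laws of $(G_n,Z_n)\in M\times M^\perp$ under $T_{n,k_n}$ and $T_{n,k_n+1}$ (same centering), and $P_n^J,Q_n^J$ the corresponding laws of $Z_n$. In the disjoint case the totals $N(D_b)=T_{b,n}(Z_n)$ are functions of $Z_n$. Let $\vartheta_{b,n}=W_b^{(n)}(\cdot\mid D_b)$. Given $z$, let $X_0^\circ,X_1^\circ$ be independent with $X_b^\circ\sim\mathrm{Mult}(T_{b,n}(z),\vartheta_{b,n})$, and let $R_{n,z}$ be the law of $G_n(X_0^\circ+X_1^\circ)$. The *auxiliary common-factor experiment* is $$\widetilde P_n(dg,dz)=P_n^J(dz)\,R_{n,z}(dg),\qquad \widetilde Q_n(dg,dz)=Q_n^J(dz)\,R_{n,z}(dg).$$ Its *block-centered* version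 replaces $G_n(X_0^\circ+X_1^\circ)$ by $n^{-1/2}\Pi_G\sum_b\sum_{y\in D_b}(X_b^\circ(y)-T_{b,n}(z)\vartheta_{b,n}(y))e_y$. Finally $\mathrm{TV}(\mu,\nu)=\sup_A|\mu(A)-\nu(A)|$, and $a_n\asymp b_n$ means $c\,b_n\le a_n\le C\,b_n$ for some constants $c,C>0$ and all large $n$. **Theorem (Sharpness of the $n^{-1/2}$ hybrid rate).** 1. Let $p,q\in(0,1)$ with $q\ne p$, $\lambda>0$, $\pi\in(0,1)$, and let $k_n\in\{0,\dots,n-1\}$ satisfy $k_n/n\to\pi$. On $\mathcal Y=\{a,b,c,d\}$ with $D_0=\{a,b\}$ and $D_1=\{c,d\}$ put $r_n=\min(1,\lambda/n)$ and $$W_0^{(n)}=(p,\,1-p,\,0,\,0),\qquad W_1^{(n)}=\bigl(r_nq,\ r_n(1-q),\ p(1-r_n),\ (1-p)(1-r_n)\bigr),$$ with limits $p_0=p_1=(p,1-p)$, $\alpha_0=0$ and $\alpha_1=(\lambda q,\lambda(1-q))$ on $\{a,b\}$. This is a two-dominant disjoint interior shuffle array; it is quantitative whenever $|k_n/n-\pi|=O(1/n)$;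 and $$\mathrm{TV}(P_n,\widetilde P_n)+\mathrm{TV}(Q_n,\widetilde Q_n)\asymp n^{-1/2}.$$ If $p=1/2$, the same holds for the block-centered auxiliary experiment. 2. Consequently the $O(n^{-1/2})$ comparison step cannot in general be improved: there is a quantitative two-dominant disjoint interior shuffle array for which $\mathrm{TV}(P_n,\widetilde P_n)+\mathrm{TV}(Q_n,\widetilde Q_n)$ is not $o(n^{-1/2})$, neither for the auxiliary experiment nor for its block-centered version. -/

import Mathlib

open MeasureTheory ProbabilityTheory Filter Topology Asymptotics

noncomputable section

namespace Shuffle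

/-- Total variation distance, `sup_A |μ(A) - ν(A)|` over measurable sets `A`. -/
def tv {X : Type*} [MeasurableSpace X] (μ ν : Measure X) : ℝ :=
  ⨆ A : {A : Set X // MeasurableSet A}, |μ.real A.1 - ν.real A.1|

/-- The histogram `N(y) = #{i : Y_i = y}` of a list of messages. -/
def hist {Y : Type*} [DecidableEq Y] {m : ℕ} (msg : Fin m → Y) (y : Y) : ℕ :=
  (Finset.univ.filter fun i => msg i = y).card

/-- The data of a shuffle array on the finite alphabet `Y`: local randomizers, dominant sets,
dominant laws (used on `D b` only), rare intensities (used off `D b` only), a composition sequence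
and its limiting proportion. The conditions on these data are `ShuffleArray.InCriticalRegime`. -/
structure ShuffleArray (Y : Type*) where
  W : ℕ → Fin 2 → PMF Y
  D : Fin 2 → Finset Y
  p : Fin 2 → Y → ℝ
  α : Fin 2 → Y → ℝ
  k : ℕ → ℕ
  ratio : ℝ

namespace ShuffleArray

variable {Y : Type*} [Fintype Y] [DecidableEq Y] (A : ShuffleArray Y)

/-- The finite-dominant sparse-error critical regime. -/
structure InCriticalRegime : Prop where
  dominant_nonempty : ∀ b, (A.D b).Nonempty
  p_pos : ∀ b, ∀ y ∈ A.D b, 0 < A.p b y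
  p_sum : ∀ b, ∑ y ∈ A.D b, A.p b y = 1
  α_nonneg : ∀ b, ∀ y ∉ A.D b, 0 ≤ A.α b y
  dominant : ∀ b, ∀ y ∈ A.D b,
    (fun n : ℕ => (A.W n b y).toReal - A.p b y) =O[atTop] fun n : ℕ => (n : ℝ)⁻¹
  rare : ∀ b, ∀ y ∉ A.D b,
    Tendsto (fun n : ℕ => (n : ℝ) * (A.W n b y).toReal) atTop (𝓝 (A.α b y))
  k_lt : ∀ n, 1 ≤ n → A.k n < n
  k_tendsto : Tendsto (fun n : ℕ => (A.k n : ℝ) / n) atTop (𝓝 A.ratio)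

/-- Two dominant outputs for each input, with disjoint dominant sets. -/
def TwoDominantDisjoint : Prop :=
  (∀ b, (A.D b).card = 2) ∧ Disjoint (A.D 0) (A.D 1)

/-- Interior compositions: the limiting proportion of ones lies in `(0, 1)`. -/
def Interior : Prop := 0 < A.ratio ∧ A.ratio < 1

/-- The quantitative form of the critical regime, with all errors of order `1 / n`. -/
def Quantitative : Prop :=
  ∃ C₀ : ℝ, ∀ᶠ n : ℕ in atTop, ∀ b,
    (∑ y ∈ A.D b, |(A.W n b y).toReal - A.p b y|
      + ∑ y ∈ (A.D b)ᶜ, |(n : ℝ) * (A.W n b y).toReal - A.α b y|)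
      + |(A.k n : ℝ) / n - A.ratio| ≤ C₀ / n

/-- The standard basis vector `e_y` of `ℝ^Y`. -/
def e (y : Y) : EuclideanSpace ℝ Y := EuclideanSpace.single y 1

/-- `μ_b = ∑_{y ∈ D_b} p_b(y) e_y`. -/
def mean (b : Fin 2) : EuclideanSpace ℝ Y := ∑ y ∈ A.D b, A.p b y • e y

/-- `M_b = span {e_y - μ_b : y ∈ D_b}`. -/
def tangent (b : Fin 2) : Submodule ℝ (EuclideanSpace ℝ Y) :=
  Submodule.span ℝ ((fun y => e y - A.mean b) '' (A.D b : Set Y))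

/-- The dominant tangent space `M = M_0 + M_1`. -/
def M : Submodule ℝ (EuclideanSpace ℝ Y) := A.tangent 0 ⊔ A.tangent 1

/-- The number of users holding `b` under the null composition: `n - k_n` zeros, `k_n` ones. -/
def groupSize (n : ℕ) (b : Fin 2) : ℝ := if b = 0 then (n : ℝ) - A.k n else A.k n

/-- The centered histogram `h - (n - k_n) μ_0 - k_n μ_1`. -/
def centered (n : ℕ) (h : Y → ℕ) : EuclideanSpace ℝ Y :=
  WithLp.toLp 2 (fun y => (h y : ℝ)) - A.groupSize n 0 • A.mean 0 - A.groupSize n 1 • A.mean 1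

/-- The rescaled dominant coordinate `G_n = n^{-1/2} Π_G Ĥ_n`. -/
def gaussPart (n : ℕ) (h : Y → ℕ) : A.M :=
  (Real.sqrt n)⁻¹ • A.M.orthogonalProjectionOnto (A.centered n h)

/-- The quotient coordinate `Z_n = Π_J Ĥ_n`. -/
def jumpPart (n : ℕ) (h : Y → ℕ) : A.Mᗮ := A.Mᗮ.orthogonalProjectionOnto (A.centered n h)

/-- The hybrid statistic `S_n = (G_n, Z_n)` as a function of the released histogram. -/
def stat (n : ℕ) (h : Y → ℕ) : A.M × A.Mᗮ := (A.gaussPart n h, A.jumpPart n h)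

/-- The dominant total on `D_b` read off from the quotient statistic: `∑_{y ∈ D_b} z(y)` is
`N(D_b)` minus the null size of group `b` (see `total_jumpPart`), and `⌊· + 1/2⌋₊` turns the
resulting real number into a natural number. -/
def total (n : ℕ) (b : Fin 2) (z : A.Mᗮ) : ℕ :=
  ⌊∑ y ∈ A.D b, (z : EuclideanSpace ℝ Y) y + A.groupSize n b + 1 / 2⌋₊

theorem measurable_total (n : ℕ) (b : Fin 2) : Measurable (A.total n b) := by
  unfold total
  refine Measurable.nat_floor ?_
  refine Measurable.add_const (Measurable.add_const ?_ _) _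
  refine Finset.measurable_sum _ fun y _ => ?_
  exact ((EuclideanSpace.proj (𝕜 := ℝ) y).continuous.comp continuous_subtype_val).measurable

/-- In the disjoint case the dominant totals are functions of the quotient statistic. -/
theorem total_jumpPart (hreg : A.InCriticalRegime) (hD : Disjoint (A.D 0) (A.D 1))
    (n : ℕ) (b : Fin 2) (h : Y → ℕ) :
    A.total n b (A.jumpPart n h) = ∑ y ∈ A.D b, h y := by
  have hmean : ∀ c, ∑ y ∈ A.D b, A.mean c y = if c = b then 1 else 0 := by
    intro c
    have h1 : ∀ y, A.mean c y = if y ∈ A.D c then A.p c y else 0 := by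
      intro y
      simp [mean, e, Pi.single_apply]
    simp only [h1]
    split_ifs with hc
    · subst hc
      rw [← hreg.p_sum c]
      exact Finset.sum_congr rfl fun y hy => by simp [hy]
    · refine Finset.sum_eq_zero fun y hy => ?_
      have : y ∉ A.D c := by
        intro hy'
        rw [Finset.disjoint_left] at hD
        fin_cases b <;> fin_cases c <;> simp_all
      simp [this]
  let one : EuclideanSpace ℝ Y := WithLp.toLp 2 fun y => if y ∈ A.D b then 1 else 0
  have hin : ∀ v : EuclideanSpace ℝ Y, inner ℝ one v = ∑ y ∈ A.D b, v y := by
    intro v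
    simp [one, PiLp.inner_apply]
  have hone : one ∈ A.Mᗮ := by
    rw [M, Submodule.mem_orthogonal']
    have key : ∀ c, ∀ u ∈ A.tangent c, inner ℝ one u = 0 := by
      intro c u hu
      refine Submodule.span_induction (p := fun u _ => inner ℝ one u = 0) ?_ (by simp)
        (fun a d _ _ ha hd => by rw [inner_add_right, ha, hd, add_zero])
        (fun r a _ ha => by rw [inner_smul_right, ha, mul_zero]) hu
      rintro _ ⟨y, hy, rfl⟩
      have hy' : y ∈ A.D c := hy
      rw [inner_sub_right, hin, hin, hmean]
      have : ∑ z ∈ A.D b, (e y : EuclideanSpace ℝ Y) z = if y ∈ A.D b then 1 else 0 := by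
        simp [e]
      rw [this]
      rw [Finset.disjoint_left] at hD
      fin_cases b <;> fin_cases c <;> simp_all
      exact fun hh => hD hh hy
    intro u hu
    obtain ⟨a, ha, d, hd, rfl⟩ := Submodule.mem_sup.1 hu
    rw [inner_add_right, key 0 a ha, key 1 d hd, add_zero]
  have hsum : ∑ y ∈ A.D b, (A.jumpPart n h : EuclideanSpace ℝ Y) y
      = ∑ y ∈ A.D b, A.centered n h y := by
    rw [← hin, ← hin]
    exact Submodule.inner_orthogonalProjectionOnto_eq_of_mem_left (K := A.Mᗮ) ⟨one, hone⟩
      (A.centered n h)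
  have hcen : ∑ y ∈ A.D b, A.centered n h y = (∑ y ∈ A.D b, (h y : ℝ)) - A.groupSize n b := by
    simp only [centered, PiLp.sub_apply, PiLp.smul_apply, Finset.sum_sub_distrib, smul_eq_mul,
      ← Finset.mul_sum, hmean]
    fin_cases b <;> simp
  unfold total
  rw [hsum, hcen, sub_add_cancel, ← Nat.cast_sum]
  rw [Nat.floor_eq_iff (by positivity)]
  constructor <;> linarith

section laws

variable [MeasurableSpace Y]

/-- The law of the histogram when user `i` holds the datum `x i` and messages are independent. -/
def shuffleLaw (n : ℕ) (x : Fin n → Fin 2) : Measure (Y → ℕ) :=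
  (Measure.pi fun i => (A.W n (x i)).toMeasure).map hist

/-- `T_{n,j}`: the histogram law for a dataset with `j` ones and `n - j` zeros. -/
def T (n j : ℕ) : Measure (Y → ℕ) :=
  A.shuffleLaw n fun i => if (i : ℕ) < j then 1 else 0

/-- The law of `S_n` under `T_{n,k_n}`. -/
def P (n : ℕ) : Measure (A.M × A.Mᗮ) := (A.T n (A.k n)).map (A.stat n)

/-- The law of `S_n`, with the same centering, under `T_{n,k_n+1}`. -/
def Q (n : ℕ) : Measure (A.M × A.Mᗮ) := (A.T n (A.k n + 1)).map (A.stat n)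

/-- The law of `Z_n` under `T_{n,k_n}`. -/
def PJ (n : ℕ) : Measure A.Mᗮ := (A.T n (A.k n)).map (A.jumpPart n)

/-- The law of `Z_n` under `T_{n,k_n+1}`. -/
def QJ (n : ℕ) : Measure A.Mᗮ := (A.T n (A.k n + 1)).map (A.jumpPart n)

/-- The normalized dominant law `ϑ_{b,n} = W_b^{(n)}(· | D_b)`. -/
def native (n : ℕ) (b : Fin 2) : Measure Y := cond (A.W n b).toMeasure (A.D b : Set Y)

/-- `Mult(t, ϑ_{b,n})`: the histogram of `t` independent draws from `ϑ_{b,n}`. -/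
def nativeBlock (n : ℕ) (b : Fin 2) (t : ℕ) : Measure (Y → ℕ) :=
  (Measure.pi fun _ : Fin t => A.native n b).map hist



/-- Given `Z_n = z`, the two dominant blocks are replaced by independent native multinomial
blocks with totals `T_{b,n}(z)`; a map `Ψ`, depending on the totals, turns the blocks into a
point of `M`. The result is a Markov kernel `z ↦ R_{n,z}` (for `n` with `W_b^{(n)}(D_b) > 0`). -/
def factor (n : ℕ) (Ψ : ℕ × ℕ → (Y → ℕ) × (Y → ℕ) → A.M) : Kernel A.Mᗮ A.M :=
  (Kernel.ofFunOfCountable fun t : ℕ × ℕ =>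
    ((A.nativeBlock n 0 t.1).prod (A.nativeBlock n 1 t.2)).map (Ψ t)).comap
  (fun z => (A.total n 0 z, A.total n 1 z))
  ((A.measurable_total n 0).prodMk (A.measurable_total n 1))

instance (n : ℕ) (b : Fin 2) : IsFiniteMeasure (A.native n b) := by
  unfold native; infer_instance

instance (n : ℕ) (b : Fin 2) (t : ℕ) : IsFiniteMeasure (A.nativeBlock n b t) := by
  unfold nativeBlock; infer_instance

instance (n : ℕ) (Ψ : ℕ × ℕ → (Y → ℕ) × (Y → ℕ) → A.M) : IsFiniteKernel (A.factor n Ψ) := by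
  have hm : ∀ {X Z : Type _} [MeasurableSpace X] [MeasurableSpace Z] (μ : Measure X) (f : X → Z),
      (μ.map f) Set.univ ≤ μ Set.univ := by
    intro X Z _ _ μ f
    by_cases hf : AEMeasurable f μ
    · rw [Measure.map_apply_of_aemeasurable hf MeasurableSet.univ, Set.preimage_univ]
    · simp [Measure.map_of_not_aemeasurable hf]
  have hn : ∀ b t, A.nativeBlock n b t Set.univ ≤ 1 := by
    intro b t
    unfold nativeBlock
    refine (hm _ _).trans ?_
    rw [Measure.pi_univ]
    refine Finset.prod_le_one' fun i _ => ?_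
    unfold native
    exact prob_le_one
  refine ⟨⟨1, ENNReal.one_lt_top, fun z => ?_⟩⟩
  unfold factor
  rw [Kernel.comap_apply]
  refine (hm _ _).trans ?_
  rw [← Set.univ_prod_univ, Measure.prod_prod]
  exact mul_le_one' (hn _ _) (hn _ _)

/-- The auxiliary experiment with common conditional factor: `P_n^J(dz) R_{n,z}(dg)`. -/
def auxP (n : ℕ) (Ψ : ℕ × ℕ → (Y → ℕ) × (Y → ℕ) → A.M) : Measure (A.M × A.Mᗮ) :=
  (A.PJ n ⊗ₘ A.factor n Ψ).map Prod.swap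

/-- The auxiliary experiment with common conditional factor: `Q_n^J(dz) R_{n,z}(dg)`. -/
def auxQ (n : ℕ) (Ψ : ℕ × ℕ → (Y → ℕ) × (Y → ℕ) → A.M) : Measure (A.M × A.Mᗮ) :=
  (A.QJ n ⊗ₘ A.factor n Ψ).map Prod.swap

/-- The dominant coordinate of the hybrid statistic, evaluated on the native blocks with the
centering `(n - k_n) μ_0 + k_n μ_1` of the statistic itself. -/
def statMap (n : ℕ) (_ : ℕ × ℕ) (x : (Y → ℕ) × (Y → ℕ)) : A.M := A.gaussPart n (x.1 + x.2)

/-- The dominant coordinate of the native blocks, each block centered by its own mean: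
`n^{-1/2} Π_G (∑_b ∑_{y ∈ D_b} (x_b(y) - t_b ϑ_b(y)) e_y)`. -/
def blockMap (n : ℕ) (t : ℕ × ℕ) (x : (Y → ℕ) × (Y → ℕ)) : A.M :=
  (Real.sqrt n)⁻¹ • A.M.orthogonalProjectionOnto
    (∑ y ∈ A.D 0, ((x.1 y : ℝ) - t.1 * (A.native n 0).real {y}) • e y
      + ∑ y ∈ A.D 1, ((x.2 y : ℝ) - t.2 * (A.native n 1).real {y}) • e y)

/-- `TV(P_n, P̃_n) + TV(Q_n, Q̃_n)`. -/
def comparisonError (Ψ : ∀ _ : ℕ, ℕ × ℕ → (Y → ℕ) × (Y → ℕ) → A.M) (n : ℕ) : ℝ :=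
  tv (A.P n) (A.auxP n (Ψ n)) + tv (A.Q n) (A.auxQ n (Ψ n))

end laws

end ShuffleArray

/-- The randomizer weights on the alphabet `0, 1, 2, 3` (the letters `a, b, c, d`). Input `0` gives
`(p, 1 - p, 0, 0)`; input `1` gives `(r q, r (1 - q), p (1 - r), (1 - p) (1 - r))`. -/
def sharpWeight (p q r : ℝ) (b : Fin 2) : Fin 4 → ℝ :=
  if b = 0 then ![p, 1 - p, 0, 0] else ![r * q, r * (1 - q), p * (1 - r), (1 - p) * (1 - r)]

/-- The weights form a probability law. -/
theorem sharpWeight_sum {p q r : ℝ} (hp : p ∈ Set.Icc (0 : ℝ) 1) (hq : q ∈ Set.Icc (0 : ℝ) 1)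
    (hr : r ∈ Set.Icc (0 : ℝ) 1) (b : Fin 2) :
    ∑ y, ENNReal.ofReal (sharpWeight p q r b y) = 1 := by
  obtain ⟨hp0, hp1⟩ := hp
  obtain ⟨hq0, hq1⟩ := hq
  obtain ⟨hr0, hr1⟩ := hr
  have h1 : 0 ≤ r * q := by positivity
  have h2 : 0 ≤ r * (1 - q) := mul_nonneg hr0 (by linarith)
  have h3 : 0 ≤ p * (1 - r) := mul_nonneg hp0 (by linarith)
  have h4 : 0 ≤ (1 - p) * (1 - r) := mul_nonneg (by linarith) (by linarith)
  rw [← ENNReal.ofReal_sum_of_nonneg, ENNReal.ofReal_eq_one]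
  · fin_cases b
    · simp [sharpWeight, Fin.sum_univ_four]
    · simp [sharpWeight, Fin.sum_univ_four]; ring
  · intro y _
    fin_cases b <;> fin_cases y <;> simp [sharpWeight, *]

/-- The cross rate `min (1, lam / n)`, which is `lam / n` as soon as `n ≥ lam`. -/
def crossRate (lam : ℝ) (n : ℕ) : ℝ := min 1 (lam / n)

theorem crossRate_mem {lam : ℝ} (hl : 0 ≤ lam) (n : ℕ) : crossRate lam n ∈ Set.Icc (0 : ℝ) 1 :=
  ⟨le_min zero_le_one (by positivity), min_le_left _ _⟩

/-- The two-dominant disjoint array with native split `(p, 1 - p)` in both dominant blocks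
`{0, 1}` and `{2, 3}`, in which a user with input `1` lands in `{0, 1}` with probability `lam / n`
and then splits as `(q, 1 - q)`. -/
def sharpArray (p q lam ratio : ℝ) (k : ℕ → ℕ) (hp : p ∈ Set.Icc (0 : ℝ) 1)
    (hq : q ∈ Set.Icc (0 : ℝ) 1) (hl : 0 ≤ lam) : ShuffleArray (Fin 4) where
  W n b := PMF.ofFintype (fun y => ENNReal.ofReal (sharpWeight p q (crossRate lam n) b y))
    (sharpWeight_sum hp hq (crossRate_mem hl n) b)
  D b := if b = 0 then {0, 1} else {2, 3}
  p b := if b = 0 then ![p, 1 - p, 0, 0] else ![0, 0, p, 1 - p]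
  α b := if b = 0 then 0 else ![lam * q, lam * (1 - q), 0, 0]
  k := k
  ratio := ratio

end Shuffle

end

namespace Shuffle

/-! A finitely supported signed measure on histograms is encoded as a polynomial, so that
independent messages multiply. Write `U = p X₀ + (1-p) X₁` and `V_s = r (s X₀ + (1-s) X₁) + (1-r)(p
X₂ + (1-p) X₃)`. The law `T_{n,j}` becomes `U^(n-j) V_q^j`. Redrawing each block from its native law
is the substitution `X₀, X₁ ↦ U`, `X₂, X₃ ↦ p X₂ + (1-p) X₃`; it fixes `U` and sends `V_q` to `V_p`.
Hence the auxiliary law is that of the statistic for `U^(n-j) V_p^j` (`sharpArray_aux_real`), and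
the whole comparison concerns `U^m (V_q^j - V_p^j)` with `m = n - j`, where `V_q - V_p = r (q-p)(X₀
- X₁)`.

Upper bound: telescoping leaves `j` terms, each of mass at most `r |q-p|` times that of `U^m (X₀ -
X₁)`. The native users smooth this difference: it is a centered binomial divided by its variance, so
its mass is at most an inverse standard deviation (`massLE_binomial_shift`). Since `j r ≤ λ`, the
total is `O(n^{-1/2})`.

Lower bound: on the event of exactly one crossing user and at most `K` messages `0`, the difference
equals `j r (1-r)^(j-1) (p-q)` times one binomial probability (`ev_crossEvent_sharpWeight_sub`). At
a mode this probability is of order at least `m^{-1/2}`, and the other factors stay away from zero.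
The statistic is injective, so the event is visible to it.

Both centerings are handled together through `AgreesOnBlocks`; for `p = 1/2` they have the same
projection on `M`. -/

open MvPolynomial in
/-- The linear functional on polynomials sending the monomial with exponent `h` to `f h`. A finitely
supported signed measure on `Y → ℕ` is encoded by its generating polynomial, and `ev f` integrates
`f` against it. -/
noncomputable def ev {Y : Type*} (f : (Y → ℕ) → ℝ) : MvPolynomial Y ℝ →ₗ[ℝ] ℝ :=
  (basisMonomials Y ℝ).constr ℝ fun s => f s

/-- The generating polynomial `∑ y, w y X_y` of one message with weights `w`. -/
noncomputable def lin {Y : Type*} [Fintype Y] (w : Y → ℝ) : MvPolynomial Y ℝ :=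
  ∑ y, w y • MvPolynomial.X y

/-! ### Signed measures as polynomials, and their total mass -/

section ev

variable {Y : Type*}

theorem ev_monomial (f : (Y → ℕ) → ℝ) (s : Y →₀ ℕ) (c : ℝ) :
    ev f (MvPolynomial.monomial s c) = c * f s := by
  have h : MvPolynomial.monomial s c = c • MvPolynomial.basisMonomials Y ℝ s := by
    simp [MvPolynomial.smul_monomial]
  rw [h, map_smul, ev, Module.Basis.constr_basis, smul_eq_mul]

/-- Monomials form a basis. This is how expectations are turned into algebra: shifts, coefficient
extraction and kernel integration need checking only on point masses. -/
theorem ev_linearMap {f : (Y → ℕ) → ℝ} {φ : MvPolynomial Y ℝ →ₗ[ℝ] ℝ}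
    (h : ∀ s : Y →₀ ℕ, φ (MvPolynomial.monomial s 1) = f s) (P : MvPolynomial Y ℝ) :
    ev f P = φ P := by
  have : ev f = φ := (MvPolynomial.basisMonomials Y ℝ).ext fun s => by
    simp [ev_monomial, h]
  rw [this]

theorem ev_X_mul [DecidableEq Y] (f : (Y → ℕ) → ℝ) (y : Y) (P : MvPolynomial Y ℝ) :
    ev f (MvPolynomial.X y * P) = ev (fun h => f (Pi.single y 1 + h)) P := by
  refine (ev_linearMap (φ := ev f ∘ₗ LinearMap.mulLeft ℝ (MvPolynomial.X y)) ?_ P).symm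
  intro s
  simp only [LinearMap.comp_apply, LinearMap.mulLeft_apply]
  rw [MvPolynomial.X, MvPolynomial.monomial_mul, ev_monomial, one_mul, one_mul]
  congr 1
  ext z
  simp [Finsupp.single_apply, Pi.single_apply, eq_comm]

/-- `P` has total mass at most `c`. -/
def MassLE (P : MvPolynomial Y ℝ) (c : ℝ) : Prop :=
  ∀ f : (Y → ℕ) → ℝ, (∀ h, |f h| ≤ 1) → |ev f P| ≤ c

theorem MassLE.smul {P : MvPolynomial Y ℝ} {c : ℝ} (h : MassLE P c) (a : ℝ) :
    MassLE (a • P) (|a| * c) := by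
  intro f hf
  rw [map_smul, smul_eq_mul, abs_mul]
  exact mul_le_mul_of_nonneg_left (h f hf) (abs_nonneg a)

theorem MassLE.sum {ι : Type*} {s : Finset ι} {P : ι → MvPolynomial Y ℝ} {c : ι → ℝ}
    (h : ∀ i ∈ s, MassLE (P i) (c i)) : MassLE (∑ i ∈ s, P i) (∑ i ∈ s, c i) := by
  intro f hf
  rw [map_sum]
  exact (Finset.abs_sum_le_sum_abs _ _).trans (Finset.sum_le_sum fun i hi => h i hi f hf)

theorem MassLE.X_mul {P : MvPolynomial Y ℝ} {c : ℝ} (h : MassLE P c) (y : Y) :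
    MassLE (MvPolynomial.X y * P) c := by
  classical
  intro f hf
  rw [ev_X_mul]
  exact h _ fun _ => hf _

variable [Fintype Y]

/-- Convolution with a probability law does not increase total mass. -/
theorem MassLE.lin_mul {P : MvPolynomial Y ℝ} {c : ℝ} (h : MassLE P c) {w : Y → ℝ}
    (hw : ∀ y, 0 ≤ w y) (hs : ∑ y, w y = 1) : MassLE (lin w * P) c := by
  have h1 : lin w * P = ∑ y, w y • (MvPolynomial.X y * P) := by
    simp [lin, Finset.sum_mul]
  have h2 : c = ∑ y, |w y| * c := by
    simp [← Finset.sum_mul, abs_of_nonneg (hw _), hs]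
  rw [h1, h2]
  exact MassLE.sum fun y _ => (h.X_mul y).smul (w y)

theorem MassLE.lin_pow_mul {P : MvPolynomial Y ℝ} {c : ℝ} (h : MassLE P c) {w : Y → ℝ}
    (hw : ∀ y, 0 ≤ w y) (hs : ∑ y, w y = 1) (i : ℕ) : MassLE (lin w ^ i * P) c := by
  induction i with
  | zero => simpa using h
  | succ i ih => rw [pow_succ', mul_assoc]; exact ih.lin_mul hw hs

/-- Replacing the messages of `j` users one at a time. -/
theorem MassLE.lin_pow_sub_lin_pow_mul {P D : MvPolynomial Y ℝ} {c : ℝ} (h : MassLE (P * D) c)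
    {w w' : Y → ℝ} (hw : ∀ y, 0 ≤ w y) (hs : ∑ y, w y = 1) (hw' : ∀ y, 0 ≤ w' y)
    (hs' : ∑ y, w' y = 1) {a : ℝ} (hD : lin w - lin w' = a • D) (j : ℕ) :
    MassLE (P * (lin w ^ j - lin w' ^ j)) (j * (|a| * c)) := by
  -- Telescoping by the geometric sum. The factor `P * D` is kept whole in every term, so that the
  -- smoothing of `D` by `P` is never lost.
  have h1 : P * (lin w ^ j - lin w' ^ j)
      = ∑ i ∈ Finset.range j, a • (lin w ^ i * (lin w' ^ (j - 1 - i) * (P * D))) := by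
    rw [← geom_sum₂_mul, hD, ← Finset.smul_sum, mul_smul_comm, mul_smul_comm, Finset.sum_mul,
      Finset.mul_sum]
    congr 1
    exact Finset.sum_congr rfl fun i _ => by ring
  have h2 : (j : ℝ) * (|a| * c) = ∑ i ∈ Finset.range j, |a| * c := by simp
  rw [h1, h2]
  exact MassLE.sum fun i _ => ((h.lin_pow_mul hw' hs' _).lin_pow_mul hw hs i).smul a

end ev

/-! ### Binomial laws: moments, mode, smoothing -/

section binomial

/-- The binomial mean, by absorbing `k` into the binomial coefficient. It is stated over a
commutative ring because `x` and `y` will be polynomials. -/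
theorem sum_mul_choose_mul_pow {R : Type*} [CommRing R] (x y : R) (n : ℕ) :
    ∑ k ∈ Finset.range (n + 2), (k : R) * (((n + 1).choose k : R) * x ^ k * y ^ (n + 1 - k))
      = (n + 1) * x * (x + y) ^ n := by
  rw [Finset.sum_range_succ', add_pow, Finset.mul_sum]
  simp only [Nat.cast_zero, zero_mul, add_zero]
  refine Finset.sum_congr rfl fun k _ => ?_
  have h : ((n + 1 : ℕ) : R) * (n.choose k : R) = ((n + 1).choose (k + 1) : R) * ((k + 1 : ℕ) : R) := by
    exact_mod_cast congrArg (Nat.cast (R := R)) (Nat.add_one_mul_choose_eq n k)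
  push_cast at h
  rw [show n + 1 - (k + 1) = n - k by omega, pow_succ]
  push_cast
  linear_combination (-(x ^ k * x * y ^ (n - k))) * h

/-- The binomial probability of `k` successes in `n` trials. -/
def binom (n : ℕ) (p : ℝ) (k : ℕ) : ℝ := n.choose k * p ^ k * (1 - p) ^ (n - k)

theorem binom_nonneg {p : ℝ} (hp : p ∈ Set.Icc (0 : ℝ) 1) (n k : ℕ) : 0 ≤ binom n p k := by
  have h0 := hp.1
  have h1 : 0 ≤ 1 - p := sub_nonneg.2 hp.2
  unfold binom
  positivity

theorem sum_binom (n : ℕ) (p : ℝ) : ∑ k ∈ Finset.range (n + 1), binom n p k = 1 := by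
  have h := add_pow p (1 - p) n
  rw [add_sub_cancel, one_pow] at h
  rw [h]
  exact Finset.sum_congr rfl fun k _ => by unfold binom; ring

theorem binom_variance (n : ℕ) (p : ℝ) :
    ∑ k ∈ Finset.range (n + 1), (k - n * p) ^ 2 * binom n p k = n * (p * (1 - p)) := by
  have h := congrArg (Polynomial.eval p) (bernsteinPolynomial.variance ℝ n)
  simp only [bernsteinPolynomial, Polynomial.eval_finsetSum] at h
  simp only [Polynomial.eval_mul, Polynomial.eval_pow, Polynomial.eval_sub,
    Polynomial.eval_X, Polynomial.eval_natCast, Polynomial.eval_one, nsmul_eq_mul] at h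
  rw [← mul_assoc, ← h]
  exact Finset.sum_congr rfl fun k _ => by unfold binom; ring

theorem binom_mean_abs_deviation_le {p : ℝ} (hp : p ∈ Set.Ioo (0 : ℝ) 1) {n : ℕ} (hn : 0 < n) :
    ∑ k ∈ Finset.range (n + 1), |(k : ℝ) - n * p| * binom n p k ≤ Real.sqrt (n * (p * (1 - p))) := by
  have h1 : 0 < 1 - p := sub_pos.2 hp.2
  have h0 := hp.1
  set s := Real.sqrt (n * (p * (1 - p))) with hs
  have hs0 : 0 < s := Real.sqrt_pos.2 (by positivity)
  have hs2 : s ^ 2 = n * (p * (1 - p)) := Real.sq_sqrt (by positivity)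
  -- Pointwise AM-GM in place of Cauchy-Schwarz: `|d| ≤ d²/(2s) + s/2`. With `s` the standard
  -- deviation, the two parts sum to `s/2` each.
  have key : ∀ k ∈ Finset.range (n + 1), |(k : ℝ) - n * p| * binom n p k
      ≤ (2 * s)⁻¹ * ((k - n * p) ^ 2 * binom n p k) + s / 2 * binom n p k := by
    intro k _
    have hb := binom_nonneg (Set.Ioo_subset_Icc_self hp) n k
    rw [← mul_assoc, ← add_mul]
    refine mul_le_mul_of_nonneg_right ?_ hb
    have h2 : 2 * s * |(k : ℝ) - n * p| ≤ (k - n * p) ^ 2 + s ^ 2 := by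
      nlinarith [sq_nonneg (|(k : ℝ) - n * p| - s), sq_abs ((k : ℝ) - n * p)]
    rw [← mul_le_mul_iff_of_pos_left (show 0 < 2 * s by positivity)]
    refine h2.trans (le_of_eq ?_)
    field_simp
  refine (Finset.sum_le_sum key).trans (le_of_eq ?_)
  rw [Finset.sum_add_distrib, ← Finset.mul_sum, ← Finset.mul_sum, binom_variance, sum_binom, ← hs2]
  field_simp
  norm_num

/-- The mode of a binomial law carries mass of order at least `n^{-1/2}`. -/
theorem exists_le_binom {p : ℝ} (hp : p ∈ Set.Icc (0 : ℝ) 1) {n : ℕ} (hn : 0 < n) :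
    ∃ k, (5 * Real.sqrt n)⁻¹ ≤ binom n p k := by
  have hn' : (1 : ℝ) ≤ n := by exact_mod_cast hn
  set t := Real.sqrt n with ht
  have ht1 : 1 ≤ t := Real.one_le_sqrt.2 hn'
  have ht2 : t ^ 2 = n := Real.sq_sqrt (by positivity)
  by_contra! hlt
  set β := (5 * t)⁻¹ with hβ
  have hβ0 : 0 < β := by positivity
  -- Chebyshev: mass at most `p(1-p) ≤ 1/4` lies outside this window, which contains at most `2t + 1
  -- ≤ 3t` integers. Were all masses below `1/(5t)`, the total would be at most `1/4 + 3/5 < 1`.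
  set S := (Finset.range (n + 1)).filter fun k : ℕ => |(k : ℝ) - n * p| < t with hS
  have hterm : ∀ k ∈ Finset.range (n + 1), binom n p k
      ≤ (n : ℝ)⁻¹ * ((k - n * p) ^ 2 * binom n p k) + if |(k : ℝ) - n * p| < t then β else 0 := by
    intro k _
    have hb := binom_nonneg hp n k
    split_ifs with hk
    · have : 0 ≤ (n : ℝ)⁻¹ * ((k - n * p) ^ 2 * binom n p k) := by positivity
      linarith [(hlt k).le]
    · push Not at hk
      have h2 : (n : ℝ) ≤ (k - n * p) ^ 2 := by
        calc (n : ℝ) = t ^ 2 := ht2.symm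
          _ ≤ |(k : ℝ) - n * p| ^ 2 := by gcongr
          _ = _ := sq_abs _
      rw [add_zero, ← mul_assoc]
      refine le_mul_of_one_le_left hb ?_
      rw [inv_mul_eq_div, one_le_div (by positivity)]
      exact h2
  have hcard : (S.card : ℝ) ≤ 2 * t + 1 := by
    have hsub : S.image (Nat.cast : ℕ → ℤ) ⊆ Finset.Icc ⌈n * p - t⌉ ⌊n * p + t⌋ := by
      intro z hz
      obtain ⟨k, hk, rfl⟩ := Finset.mem_image.1 hz
      have hk2 := abs_lt.1 (Finset.mem_filter.1 hk).2
      rw [Finset.mem_Icc, Int.ceil_le, Int.le_floor]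
      push_cast
      constructor <;> linarith
    have h1 := Finset.card_le_card hsub
    rw [Finset.card_image_of_injective _ Nat.cast_injective, Int.card_Icc] at h1
    have h2 : (S.card : ℤ) ≤ max (⌊n * p + t⌋ + 1 - ⌈n * p - t⌉) 0 := by
      rw [← Int.toNat_eq_max]; exact_mod_cast h1
    have h3 : (S.card : ℝ) ≤ max ((⌊n * p + t⌋ : ℝ) + 1 - ⌈n * p - t⌉) 0 := by exact_mod_cast h2
    refine h3.trans (max_le ?_ (by positivity))
    have := Int.floor_le (n * p + t)
    have := Int.le_ceil (n * p - t)
    linarith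
  have hsum := Finset.sum_le_sum hterm
  rw [sum_binom, Finset.sum_add_distrib, ← Finset.mul_sum, binom_variance, ← Finset.sum_filter,
    Finset.sum_const, nsmul_eq_mul, ← mul_assoc, inv_mul_cancel₀ (by positivity), one_mul] at hsum
  have hp4 : p * (1 - p) ≤ 1 / 4 := by nlinarith [sq_nonneg (p - 1 / 2)]
  have h5 : (S.card : ℝ) * β ≤ 3 * t * β := by
    gcongr
    linarith
  have h6 : 3 * t * β = 3 / 5 := by rw [hβ]; field_simp
  linarith

section shift

open MvPolynomial

variable {Y : Type*}

/-- Adding one more message to a binomial block: the laws of a block with an extra `a` and with an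
extra `b` differ by the centered block with one more user. -/
theorem binomial_shift (a b : Y) (p : ℝ) (n : ℕ) :
    ((n + 1) * (p * (1 - p))) • ((p • X a + (1 - p) • X b : MvPolynomial Y ℝ) ^ n * (X a - X b))
      = ∑ k ∈ Finset.range (n + 2), ((k - (n + 1 : ℕ) * p) * binom (n + 1) p k) •
          monomial (Finsupp.single a k + Finsupp.single b (n + 1 - k)) (1 : ℝ) := by
  have h1 := sum_mul_choose_mul_pow (p • X a : MvPolynomial Y ℝ) ((1 - p) • X b) n
  have h2 := add_pow (p • X a : MvPolynomial Y ℝ) ((1 - p) • X b) (n + 1)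
  have h3 : ∀ k, ((k - (n + 1 : ℕ) * p) * binom (n + 1) p k) •
      monomial (Finsupp.single a k + Finsupp.single b (n + 1 - k)) (1 : ℝ)
      = (k : MvPolynomial Y ℝ) * (((n + 1).choose k : MvPolynomial Y ℝ) * (p • X a) ^ k
          * ((1 - p) • X b) ^ (n + 1 - k))
        - ((n + 1) * p) • ((p • X a) ^ k * ((1 - p) • X b) ^ (n + 1 - k)
          * ((n + 1).choose k : MvPolynomial Y ℝ)) := by
    intro k
    have h4 : monomial (Finsupp.single a k + Finsupp.single b (n + 1 - k)) (1 : ℝ)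
        = X a ^ k * X b ^ (n + 1 - k) := by
      rw [X_pow_eq_monomial, X_pow_eq_monomial, monomial_mul, one_mul]
    rw [h4]
    simp only [smul_eq_C_mul, binom, mul_pow, map_mul, map_sub, map_natCast, map_pow, map_add,
      map_one]
    push_cast
    ring
  simp only [h3]
  rw [Finset.sum_sub_distrib, ← Finset.smul_sum, ← h2, h1]
  simp only [smul_eq_C_mul, map_mul, map_sub, map_natCast, map_add, map_one]
  ring

/-- By `binomial_shift` the mass is at most the mean absolute deviation of a binomial with `n + 1`
trials over its variance, hence at most one over its standard deviation. -/
theorem massLE_binomial_shift (a b : Y) {p : ℝ} (hp : p ∈ Set.Ioo (0 : ℝ) 1) (n : ℕ) :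
    MassLE ((p • X a + (1 - p) • X b : MvPolynomial Y ℝ) ^ n * (X a - X b))
      (Real.sqrt ((n + 1) * (p * (1 - p))))⁻¹ := by
  have h1 : 0 < 1 - p := sub_pos.2 hp.2
  have h0 := hp.1
  set v : ℝ := (n + 1) * (p * (1 - p)) with hv
  have hv0 : 0 < v := by positivity
  have hP : (p • X a + (1 - p) • X b : MvPolynomial Y ℝ) ^ n * (X a - X b)
      = v⁻¹ • ∑ k ∈ Finset.range (n + 2), ((k - (n + 1 : ℕ) * p) * binom (n + 1) p k) •
          monomial (Finsupp.single a k + Finsupp.single b (n + 1 - k)) (1 : ℝ) := by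
    rw [← binomial_shift, ← hv, smul_smul, inv_mul_cancel₀ hv0.ne', one_smul]
  have hmon : ∀ s : Y →₀ ℕ, MassLE (monomial s (1 : ℝ)) 1 := by
    intro s f hf
    rw [ev_monomial, one_mul]
    exact hf s
  rw [hP]
  intro f hf
  refine ((MassLE.sum fun k _ => (hmon _).smul _).smul v⁻¹ f hf).trans ?_
  have hdev := binom_mean_abs_deviation_le hp n.succ_pos
  rw [Nat.succ_eq_add_one] at hdev
  simp only [mul_one, abs_mul, abs_of_nonneg (binom_nonneg (Set.Ioo_subset_Icc_self hp) _ _)]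
  rw [abs_of_pos (inv_pos.2 hv0)]
  push_cast at hdev ⊢
  rw [← hv] at hdev
  refine (mul_le_mul_of_nonneg_left hdev (inv_pos.2 hv0).le).trans (le_of_eq ?_)
  rw [inv_mul_eq_div, Real.sqrt_div_self]

end shift

end binomial

/-! ### Splitting crossing users by `q` or by `p`: mass bound and test event -/

section weights

open MvPolynomial

theorem sharpWeight_nonneg {p q r : ℝ} (hp : p ∈ Set.Icc (0 : ℝ) 1) (hq : q ∈ Set.Icc (0 : ℝ) 1)
    (hr : r ∈ Set.Icc (0 : ℝ) 1) (b : Fin 2) (y : Fin 4) : 0 ≤ sharpWeight p q r b y := by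
  have h1 := mul_nonneg hr.1 hq.1
  have h2 := mul_nonneg hr.1 (sub_nonneg.2 hq.2)
  have h3 := mul_nonneg hp.1 (sub_nonneg.2 hr.2)
  have h4 := mul_nonneg (sub_nonneg.2 hp.2) (sub_nonneg.2 hr.2)
  have h5 := hp.1
  have h6 := hp.2
  fin_cases b <;> fin_cases y <;> simp [sharpWeight, *]

theorem sum_sharpWeight (p q r : ℝ) (b : Fin 2) : ∑ y, sharpWeight p q r b y = 1 := by
  fin_cases b <;> simp [sharpWeight, Fin.sum_univ_four]
  ring

theorem lin_sharpWeight_zero (p q r : ℝ) :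
    lin (sharpWeight p q r 0) = p • X 0 + (1 - p) • X 1 := by
  simp [lin, sharpWeight, Fin.sum_univ_four]

theorem lin_sharpWeight_one (p q r : ℝ) :
    lin (sharpWeight p q r 1)
      = r • (q • X 0 + (1 - q) • X 1) + (1 - r) • (p • X 2 + (1 - p) • X 3) := by
  simp only [lin, sharpWeight, Fin.sum_univ_four, if_neg (one_ne_zero : (1 : Fin 2) ≠ 0), smul_add,
    smul_smul]
  simp [mul_comm, add_assoc]

theorem massLE_sharpWeight_sub {p q r : ℝ} (hp : p ∈ Set.Ioo (0 : ℝ) 1)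
    (hq : q ∈ Set.Icc (0 : ℝ) 1) (hr : r ∈ Set.Icc (0 : ℝ) 1) (m j : ℕ) :
    MassLE (lin (sharpWeight p q r 0) ^ m
        * (lin (sharpWeight p q r 1) ^ j - lin (sharpWeight p p r 1) ^ j))
      (j * (|r * (q - p)| * (Real.sqrt ((m + 1) * (p * (1 - p))))⁻¹)) := by
  have hp' := Set.Ioo_subset_Icc_self hp
  refine MassLE.lin_pow_sub_lin_pow_mul (D := X 0 - X 1) ?_
    (sharpWeight_nonneg hp' hq hr 1) (sum_sharpWeight p q r 1)
    (sharpWeight_nonneg hp' hp' hr 1) (sum_sharpWeight p p r 1) ?_ j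
  · rw [lin_sharpWeight_zero]
    exact massLE_binomial_shift 0 1 hp m
  · simp only [lin_sharpWeight_one, smul_eq_C_mul, map_mul, map_sub, map_one]
    ring

/-- The indicator of exactly one crossing user, with at most `K` messages `0`. -/
def crossEvent (m K : ℕ) : Set (Fin 4 → ℕ) := {h | h 0 + h 1 = m + 1 ∧ h 0 ≤ K}

/-- The substitution recording the number of messages `0` and the size of the first block. -/
noncomputable def blockHom : MvPolynomial (Fin 4) ℝ →ₐ[ℝ] Polynomial (Polynomial ℝ) :=
  aeval ![Polynomial.C Polynomial.X * Polynomial.X, Polynomial.X, 1, 1]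

/-- The sum of the coefficients of order at most `K`. -/
noncomputable def coeffSum (K : ℕ) : Polynomial ℝ →ₗ[ℝ] ℝ :=
  ∑ i ∈ Finset.range (K + 1), Polynomial.lcoeff ℝ i

/-- Shifting a law by one changes its distribution function at `K` by exactly the mass at `K`; the
sum telescopes. -/
theorem coeffSum_mul_X_sub_one (K : ℕ) (P : Polynomial ℝ) :
    coeffSum K (P * (Polynomial.X - 1)) = -P.coeff K := by
  induction K with
  | zero => simp [coeffSum, mul_sub]
  | succ K ih =>
    simp only [coeffSum, LinearMap.sum_apply, Polynomial.lcoeff_apply] at ih ⊢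
    rw [Finset.sum_range_succ, ih, mul_sub, mul_one, Polynomial.coeff_sub,
      Polynomial.coeff_mul_X]
    ring

theorem ev_crossEvent (m K : ℕ) (P : MvPolynomial (Fin 4) ℝ) :
    ev ((crossEvent m K).indicator 1) P = coeffSum K ((blockHom P).coeff (m + 1)) := by
  refine ev_linearMap (φ := coeffSum K ∘ₗ
    (Polynomial.lcoeff (Polynomial ℝ) (m + 1)).restrictScalars ℝ ∘ₗ blockHom.toLinearMap) ?_ P
  intro s
  have h : blockHom (monomial s 1)
      = Polynomial.C (Polynomial.X ^ s 0) * Polynomial.X ^ (s 0 + s 1) := by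
    rw [blockHom, aeval_monomial, Finsupp.prod_fintype _ _ (by simp), Fin.prod_univ_four]
    simp [mul_pow, pow_add, mul_assoc]
  simp only [LinearMap.comp_apply, LinearMap.restrictScalars_apply, Polynomial.lcoeff_apply,
    AlgHom.toLinearMap_apply, h, Polynomial.coeff_C_mul_X_pow]
  by_cases h1 : s 0 + s 1 = m + 1
  · by_cases h2 : s 0 ≤ K
    · simp [crossEvent, h1, h2, coeffSum, Polynomial.coeff_X_pow]
    · simp [crossEvent, h1, h2, coeffSum, Polynomial.coeff_X_pow]
  · simp [crossEvent, h1, Ne.symm h1]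

theorem coeff_zero_linear_pow {R : Type*} [CommRing R] (a b : R) (k : ℕ) :
    ((Polynomial.C a * Polynomial.X + Polynomial.C b) ^ k).coeff 0 = b ^ k := by
  rw [Polynomial.coeff_zero_eq_eval_zero]
  simp

theorem coeff_one_linear_pow {R : Type*} [CommRing R] (a b : R) (k : ℕ) :
    ((Polynomial.C a * Polynomial.X + Polynomial.C b) ^ k).coeff 1 = k * a * b ^ (k - 1) := by
  induction k with
  | zero => simp [Polynomial.coeff_one]
  | succ k ih =>
    rw [pow_succ, Polynomial.mul_coeff_one, ih, coeff_zero_linear_pow]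
    rcases k with _ | k
    · simp
    · simp [pow_succ]
      ring

theorem coeff_binomial_pow (p : ℝ) (m K : ℕ) :
    ((Polynomial.C p * Polynomial.X + Polynomial.C (1 - p)) ^ m).coeff K = binom m p K := by
  have h : ∀ k, (Polynomial.C p * Polynomial.X) ^ k * Polynomial.C (1 - p) ^ (m - k)
      * (m.choose k : Polynomial ℝ) = Polynomial.C (binom m p k) * Polynomial.X ^ k := by
    intro k
    simp only [binom, map_mul, map_pow, map_natCast, mul_pow]
    ring
  rw [add_pow]
  simp only [h, Polynomial.finsetSum_coeff, Polynomial.coeff_C_mul_X_pow]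
  rw [Finset.sum_ite_eq]
  split_ifs with hK
  · rfl
  · rw [binom, Nat.choose_eq_zero_of_lt (by simpa [Nat.lt_succ_iff] using hK)]
    simp

/-- The `m` zero users contribute block degree exactly `m`, so degree `m + 1` selects the part of
the crossing factor linear in the block variable: one crossing user among `j`. What remains is a
multiple of the binomial generating polynomial times `X - 1`, on which the distribution function
telescopes. -/
theorem ev_crossEvent_sharpWeight_sub (p q r : ℝ) (m j K : ℕ) :
    ev ((crossEvent m K).indicator 1) (lin (sharpWeight p q r 0) ^ m
        * (lin (sharpWeight p q r 1) ^ j - lin (sharpWeight p p r 1) ^ j))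
      = j * r * (1 - r) ^ (j - 1) * (p - q) * binom m p K := by
  have h0 : blockHom (lin (sharpWeight p q r 0)) ^ m
      = Polynomial.C ((Polynomial.C p * Polynomial.X + Polynomial.C (1 - p)) ^ m)
        * Polynomial.X ^ m := by
    rw [lin_sharpWeight_zero, map_pow, ← mul_pow]
    congr 1
    simp [blockHom, Algebra.smul_def]
    ring
  have h1 : ∀ s : ℝ, blockHom (lin (sharpWeight p s r 1))
      = Polynomial.C (Polynomial.C r * (Polynomial.C s * Polynomial.X + Polynomial.C (1 - s)))
        * Polynomial.X + Polynomial.C (Polynomial.C (1 - r)) := by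
    intro s
    rw [lin_sharpWeight_one]
    simp [blockHom, Algebra.smul_def]
    ring
  rw [ev_crossEvent, map_mul, map_sub, map_pow, map_pow, map_pow, h0, h1, h1, mul_assoc,
    Polynomial.coeff_C_mul, add_comm m 1, Polynomial.coeff_X_pow_mul, Polynomial.coeff_sub,
    coeff_one_linear_pow, coeff_one_linear_pow]
  set u := (Polynomial.C p * Polynomial.X + Polynomial.C (1 - p)) ^ m with hu
  have h2 : u * ((j : Polynomial ℝ) * (Polynomial.C r * (Polynomial.C q * Polynomial.X + Polynomial.C (1 - q)))
        * Polynomial.C (1 - r) ^ (j - 1)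
      - (j : Polynomial ℝ) * (Polynomial.C r * (Polynomial.C p * Polynomial.X + Polynomial.C (1 - p)))
        * Polynomial.C (1 - r) ^ (j - 1))
      = (j * r * (1 - r) ^ (j - 1) * (q - p)) • (u * (Polynomial.X - 1)) := by
    rw [Polynomial.smul_eq_C_mul]
    simp only [map_mul, map_sub, map_pow, map_natCast, map_one]
    ring
  rw [h2, map_smul, coeffSum_mul_X_sub_one, hu, coeff_binomial_pow, smul_eq_mul]
  ring

end weights

/-! ### Histogram laws as products of one-message polynomials -/

section histogram

variable {Y : Type*}

theorem pi_real_singleton [MeasurableSpace Y] {m : ℕ} (μ : Fin m → Measure Y) [∀ i, IsFiniteMeasure (μ i)]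
    (u : Fin m → Y) : (Measure.pi μ).real {u} = ∏ i, (μ i).real {u i} := by
  simp [measureReal_def, Measure.pi_singleton, ENNReal.toReal_prod]

section

variable [DecidableEq Y]

theorem hist_eq_zero {m : ℕ} {u : Fin m → Y} {D : Finset Y} (hu : ∀ i, u i ∈ D) {y : Y}
    (hy : y ∉ D) : hist u y = 0 := by
  rw [hist, Finset.card_eq_zero, Finset.filter_eq_empty_iff]
  rintro i _ rfl
  exact hy (hu i)

theorem sum_hist {m : ℕ} {u : Fin m → Y} {D : Finset Y} (hu : ∀ i, u i ∈ D) :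
    ∑ y ∈ D, hist u y = m := by
  have h := Finset.card_eq_sum_card_fiberwise (f := u) (s := Finset.univ) (t := D)
    fun i _ => hu i
  rw [Finset.card_univ, Fintype.card_fin] at h
  exact h.symm

end

variable [Fintype Y] [DecidableEq Y]

theorem prod_lin {m : ℕ} (w : Fin m → Y → ℝ) :
    ∏ i, lin (w i) = ∑ u : Fin m → Y, (∏ i, w i (u i)) •
      MvPolynomial.monomial (Finsupp.equivFunOnFinite.symm (hist u)) (1 : ℝ) := by
  simp only [lin]
  rw [Finset.prod_univ_sum, Fintype.piFinset_univ]
  refine Finset.sum_congr rfl fun u _ => ?_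
  rw [Finset.prod_smul]
  congr 1
  have h : ∀ i, (MvPolynomial.X (u i) : MvPolynomial Y ℝ)
      = MvPolynomial.monomial (Finsupp.single (u i) 1) 1 := fun i => rfl
  simp only [h]
  rw [← MvPolynomial.monomial_sum_one]
  congr 2
  ext y
  rw [Finsupp.coe_equivFunOnFinite_symm, hist, Finset.card_filter, Finsupp.finsetSum_apply]
  exact Finset.sum_congr rfl fun i _ => by rw [Finsupp.single_apply]

theorem ev_prod_lin {m : ℕ} (f : (Y → ℕ) → ℝ) (w : Fin m → Y → ℝ) :
    ev f (∏ i, lin (w i)) = ∑ u : Fin m → Y, (∏ i, w i (u i)) * f (hist u) := by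
  rw [prod_lin, map_sum]
  exact Finset.sum_congr rfl fun u _ => by simp [ev_monomial]

theorem ev_prod_lin_mul {m m' : ℕ} (f : (Y → ℕ) → ℝ) (w : Fin m → Y → ℝ) (w' : Fin m' → Y → ℝ) :
    ev f ((∏ i, lin (w i)) * ∏ i, lin (w' i)) = ∑ u : (Fin m → Y) × (Fin m' → Y),
      ((∏ i, w i (u.1 i)) * ∏ i, w' i (u.2 i)) * f (hist u.1 + hist u.2) := by
  rw [prod_lin, prod_lin, Finset.sum_mul_sum, ← Finset.univ_product_univ, Finset.sum_product,
    map_sum]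
  refine Finset.sum_congr rfl fun u _ => ?_
  rw [map_sum]
  refine Finset.sum_congr rfl fun v _ => ?_
  rw [smul_mul_smul_comm, map_smul, MvPolynomial.monomial_mul, ev_monomial]
  simp

variable [MeasurableSpace Y] [MeasurableSingletonClass Y]

theorem real_fintype {X : Type*} [Fintype X] [MeasurableSpace X] [MeasurableSingletonClass X]
    (μ : Measure X) [IsFiniteMeasure μ] (S : Set X) :
    μ.real S = ∑ x, μ.real {x} * S.indicator 1 x := by
  classical
  have h := sum_measureReal_singleton (μ := μ) (Finset.univ.filter (· ∈ S))
  have hS : ((Finset.univ.filter (· ∈ S) : Finset X) : Set X) = S := by ext; simp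
  rw [hS] at h
  rw [← h, Finset.sum_filter]
  exact Finset.sum_congr rfl fun x _ => by simp [Set.indicator_apply]

theorem real_map_hist {m : ℕ} (μ : Fin m → Measure Y) [∀ i, IsFiniteMeasure (μ i)]
    (S : Set (Y → ℕ)) :
    ((Measure.pi μ).map hist).real S
      = ev (S.indicator 1) (∏ i, lin fun y => (μ i).real {y}) := by
  rw [map_measureReal_apply Measurable.of_discrete S.to_countable.measurableSet, real_fintype,
    ev_prod_lin]
  simp only [pi_real_singleton]
  rfl

end histogram

/-! ### What the statistic retains of the histogram -/

namespace ShuffleArray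

variable {Y : Type*} [Fintype Y] [DecidableEq Y] (A : ShuffleArray Y)

/-- The projections on `M` and `Mᗮ` together determine the centered histogram. Hence every event on
histograms can serve as a test event for the hybrid statistic. -/
theorem stat_injective {n : ℕ} (hn : 0 < n) : Function.Injective (A.stat n) := by
  intro h h' heq
  have h1 : A.M.orthogonalProjectionOnto (A.centered n h)
      = A.M.orthogonalProjectionOnto (A.centered n h') := by
    have h2 := congrArg Prod.fst heq
    have h3 : (Real.sqrt n)⁻¹ ≠ 0 := by positivity
    exact smul_right_injective _ h3 h2
  have h2 : A.Mᗮ.orthogonalProjectionOnto (A.centered n h)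
      = A.Mᗮ.orthogonalProjectionOnto (A.centered n h') := congrArg Prod.snd heq
  have h3 : A.centered n h = A.centered n h' := by
    rw [← A.M.starProjection_add_starProjection_orthogonal (A.centered n h),
      ← A.M.starProjection_add_starProjection_orthogonal (A.centered n h')]
    simp only [Submodule.starProjection_apply, h1, h2]
  funext y
  have h4 := congrArg (fun v : EuclideanSpace ℝ Y => v y) h3
  simpa [centered] using h4

theorem jumpPart_eq_of_sub_mem {n : ℕ} {h h' : Y → ℕ}
    (hM : WithLp.toLp 2 (fun y => (h y : ℝ)) - WithLp.toLp 2 (fun y => (h' y : ℝ)) ∈ A.M) :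
    A.jumpPart n h = A.jumpPart n h' := by
  rw [jumpPart, jumpPart, ← sub_eq_zero, ← map_sub,
    Submodule.orthogonalProjectionOnto_eq_zero_iff]
  refine Submodule.le_orthogonal_orthogonal _ ?_
  convert hM using 1
  simp only [centered]
  abel

end ShuffleArray

/-! ### Laws of the sharp array and its native conditionals -/

section sharp

variable {p q lam ratio : ℝ} {k : ℕ → ℕ} {hp : p ∈ Set.Icc (0 : ℝ) 1} {hq : q ∈ Set.Icc (0 : ℝ) 1}
  {hl : 0 ≤ lam}

local notation "𝒜" => sharpArray p q lam ratio k hp hq hl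

theorem sharpArray_W_real_singleton (n : ℕ) (b : Fin 2) (y : Fin 4) :
    ((sharpArray p q lam ratio k hp hq hl).W n b).toMeasure.real {y}
      = sharpWeight p q (crossRate lam n) b y := by
  rw [measureReal_def, PMF.toMeasure_apply_singleton _ _ (measurableSet_singleton y)]
  exact ENNReal.toReal_ofReal (sharpWeight_nonneg hp hq (crossRate_mem hl n) b y)

theorem sharpArray_T_eq (n j : ℕ) : (𝒜).T n j = (Measure.pi fun i : Fin n =>
    ((𝒜).W n (if (i : ℕ) < j then 1 else 0)).toMeasure).map hist := rfl

/-- The generating polynomial of `T_{n,j}`. -/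
theorem prod_lin_sharpWeight (r : ℝ) {n j : ℕ} (hj : j ≤ n) :
    ∏ i : Fin n, lin (sharpWeight p q r (if (i : ℕ) < j then 1 else 0))
      = lin (sharpWeight p q r 0) ^ (n - j) * lin (sharpWeight p q r 1) ^ j := by
  have h : ∀ i : Fin n, lin (sharpWeight p q r (if (i : ℕ) < j then 1 else 0))
      = if (i : ℕ) < j then lin (sharpWeight p q r 1) else lin (sharpWeight p q r 0) := by
    intro i
    split_ifs <;> rfl
  simp only [h]
  rw [Fin.prod_univ_eq_prod_range
    (fun i => if i < j then lin (sharpWeight p q r 1) else lin (sharpWeight p q r 0)) n,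
    ← Finset.prod_range_mul_prod_Ico _ hj, mul_comm]
  congr 1
  · rw [Finset.prod_congr rfl (g := fun _ => lin (sharpWeight p q r 0))]
    · simp
    · intro i hi
      rw [if_neg (not_lt.2 (Finset.mem_Ico.1 hi).1)]
  · rw [Finset.prod_congr rfl (g := fun _ => lin (sharpWeight p q r 1))]
    · simp
    · intro i hi
      rw [if_pos (Finset.mem_range.1 hi)]

theorem sharpArray_T_real {n j : ℕ} (hj : j ≤ n) (S : Set (Fin 4 → ℕ)) :
    ((𝒜).T n j).real S = ev (S.indicator 1)
      (lin (sharpWeight p q (crossRate lam n) 0) ^ (n - j)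
        * lin (sharpWeight p q (crossRate lam n) 1) ^ j) := by
  rw [sharpArray_T_eq, real_map_hist, ← prod_lin_sharpWeight _ hj]
  simp only [sharpArray_W_real_singleton]

theorem sharpArray_map_stat_real {n j : ℕ} (hj : j ≤ n)
    {S : Set ((𝒜).M × (𝒜).Mᗮ)} (hS : MeasurableSet S) :
    (((𝒜).T n j).map ((𝒜).stat n)).real S = ev (((𝒜).stat n ⁻¹' S).indicator 1)
      (lin (sharpWeight p q (crossRate lam n) 0) ^ (n - j)
        * lin (sharpWeight p q (crossRate lam n) 1) ^ j) := by
  rw [map_measureReal_apply Measurable.of_discrete hS, sharpArray_T_real hj]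

/-- Conditioning on `D_b` cancels the factor `1 - r`, so the native law is the one at rate zero, for
every `n` with `r < 1`. -/
theorem sharpArray_native_real_singleton {n : ℕ} (hr : crossRate lam n < 1) (b : Fin 2)
    (y : Fin 4) : ((𝒜).native n b).real {y} = sharpWeight p q 0 b y := by
  have hr' : 1 - crossRate lam n ≠ 0 := by linarith
  have hD : ((𝒜).W n b).toMeasure.real ((𝒜).D b : Set (Fin 4))
      = if b = 0 then 1 else 1 - crossRate lam n := by
    rw [← sum_measureReal_singleton]
    simp only [sharpArray_W_real_singleton]
    fin_cases b
    · simp [sharpArray, sharpWeight]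
    · simp [sharpArray, sharpWeight]
      ring
  rw [ShuffleArray.native, measureReal_def, cond_apply (Finset.measurableSet _),
    ENNReal.toReal_mul, ENNReal.toReal_inv, ← measureReal_def, ← measureReal_def, hD]
  by_cases hy : y ∈ (𝒜).D b
  · rw [Set.inter_eq_self_of_subset_right (Set.singleton_subset_iff.2 hy),
      sharpArray_W_real_singleton]
    fin_cases b
    · simp [sharpWeight]
    · fin_cases y <;> simp_all [sharpWeight, sharpArray] <;> field_simp
  · rw [Set.inter_singleton_eq_empty.2 (by simpa using hy)]
    fin_cases b <;> fin_cases y <;> simp_all [sharpWeight, sharpArray]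

end sharp

namespace ShuffleArray

variable {Y : Type*} [DecidableEq Y] (A : ShuffleArray Y)

theorem tangent_le_M (b : Fin 2) : A.tangent b ≤ A.M := by
  fin_cases b
  · exact le_sup_left
  · exact le_sup_right

theorem e_sub_e_mem_M {b : Fin 2} {y y' : Y} (hy : y ∈ A.D b) (hy' : y' ∈ A.D b) :
    e y - e y' ∈ A.M := by
  have h1 : e y - A.mean b ∈ A.tangent b := Submodule.subset_span ⟨y, hy, rfl⟩
  have h2 : e y' - A.mean b ∈ A.tangent b := Submodule.subset_span ⟨y', hy', rfl⟩
  have h3 := A.tangent_le_M b (Submodule.sub_mem _ h1 h2)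
  rwa [sub_sub_sub_cancel_right] at h3

variable [Fintype Y]

/-- On blocks carried by the dominant sets, `Ψ` is the dominant coordinate of the statistic. -/
def AgreesOnBlocks (n : ℕ) (Ψ : ℕ × ℕ → (Y → ℕ) × (Y → ℕ) → A.M) : Prop :=
  ∀ x : (Y → ℕ) × (Y → ℕ), (∀ y ∉ A.D 0, x.1 y = 0) → (∀ y ∉ A.D 1, x.2 y = 0) →
    Ψ (∑ y ∈ A.D 0, x.1 y, ∑ y ∈ A.D 1, x.2 y) x = A.gaussPart n (x.1 + x.2)

theorem agreesOnBlocks_statMap (n : ℕ) : A.AgreesOnBlocks n (A.statMap n) :=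
  fun _ _ _ => rfl

end ShuffleArray

/-! ### Native blocks and the auxiliary law -/

section sharp

variable {p q lam ratio : ℝ} {k : ℕ → ℕ} {hp : p ∈ Set.Icc (0 : ℝ) 1} {hq : q ∈ Set.Icc (0 : ℝ) 1}
  {hl : 0 ≤ lam}

local notation "𝒜" => sharpArray p q lam ratio k hp hq hl

theorem sharpArray_D_zero : (𝒜).D 0 = {0, 1} := rfl

theorem sharpArray_D_one : (𝒜).D 1 = {2, 3} := rfl

theorem sharpArray_jumpPart_congr (n : ℕ) {h h' : Fin 4 → ℕ} (h0 : h 0 + h 1 = h' 0 + h' 1)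
    (h1 : h 2 + h 3 = h' 2 + h' 3) : (𝒜).jumpPart n h = (𝒜).jumpPart n h' := by
  refine (𝒜).jumpPart_eq_of_sub_mem ?_
  have e0 : ShuffleArray.e (0 : Fin 4) - ShuffleArray.e 1 ∈ (𝒜).M :=
    (𝒜).e_sub_e_mem_M (b := 0) (by simp [sharpArray]) (by simp [sharpArray])
  have e1 : ShuffleArray.e (2 : Fin 4) - ShuffleArray.e 3 ∈ (𝒜).M :=
    (𝒜).e_sub_e_mem_M (b := 1) (by simp [sharpArray]) (by simp [sharpArray])
  convert Submodule.add_mem _ (Submodule.smul_mem _ ((h 0 : ℝ) - h' 0) e0)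
    (Submodule.smul_mem _ ((h 2 : ℝ) - h' 2) e1) using 1
  have h0' : (h 0 : ℝ) + h 1 = h' 0 + h' 1 := by exact_mod_cast h0
  have h1' : (h 2 : ℝ) + h 3 = h' 2 + h' 3 := by exact_mod_cast h1
  ext y
  fin_cases y <;> simp [ShuffleArray.e] <;> linarith

theorem sharpWeight_zero_eq_zero {b : Fin 2} {y : Fin 4} (hy : y ∉ (𝒜).D b) :
    sharpWeight p q 0 b y = 0 := by
  fin_cases b <;> fin_cases y <;> simp_all [sharpWeight, sharpArray]

/-- The native blocks with totals `t` reproduce the statistic of the histogram with generating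
polynomial `U_0^{t_0} U_1^{t_1}`. -/
theorem sharpArray_blocks_real {n : ℕ} (hr : crossRate lam n < 1)
    {Ψ : ℕ × ℕ → (Fin 4 → ℕ) × (Fin 4 → ℕ) → (𝒜).M} (hΨ : (𝒜).AgreesOnBlocks n Ψ)
    {S : Set ((𝒜).M × (𝒜).Mᗮ)} (hS : MeasurableSet S) (h : Fin 4 → ℕ) :
    ((((𝒜).nativeBlock n 0 (h 0 + h 1)).prod ((𝒜).nativeBlock n 1 (h 2 + h 3))).map
        (Ψ (h 0 + h 1, h 2 + h 3))).real {g | (g, (𝒜).jumpPart n h) ∈ S}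
      = ev (((𝒜).stat n ⁻¹' S).indicator 1)
        (lin (sharpWeight p q 0 0) ^ (h 0 + h 1) * lin (sharpWeight p q 0 1) ^ (h 2 + h 3)) := by
  have hm : MeasurableSet {g | (g, (𝒜).jumpPart n h) ∈ S} := measurable_prodMk_right hS
  have hpow : ∀ b t, lin (sharpWeight p q 0 b) ^ t
      = ∏ i : Fin t, lin fun y => ((𝒜).native n b).real {y} := by
    intro b t
    simp [sharpArray_native_real_singleton hr]
  rw [ShuffleArray.nativeBlock, ShuffleArray.nativeBlock,
    Measure.map_prod_map _ _ Measurable.of_discrete Measurable.of_discrete,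
    Measure.map_map Measurable.of_discrete Measurable.of_discrete,
    map_measureReal_apply Measurable.of_discrete hm, real_fintype, hpow, hpow, ev_prod_lin_mul]
  refine Finset.sum_congr rfl fun u _ => ?_
  rw [← Set.singleton_prod_singleton, measureReal_prod_prod, pi_real_singleton, pi_real_singleton]
  -- `AgreesOnBlocks` speaks only of blocks carried by the dominant sets; all other draws have
  -- weight zero.
  by_cases hu : (∀ i, u.1 i ∈ (𝒜).D 0) ∧ ∀ i, u.2 i ∈ (𝒜).D 1
  · congr 1
    have h0 := sum_hist hu.1
    have h1 := sum_hist hu.2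
    have hΨu := hΨ (hist u.1, hist u.2) (fun y => hist_eq_zero hu.1) fun y => hist_eq_zero hu.2
    simp only [h0, h1] at hΨu
    have hz0 : ∀ y ∉ (𝒜).D 0, hist u.1 y = 0 := fun y => hist_eq_zero hu.1
    have hz1 : ∀ y ∉ (𝒜).D 1, hist u.2 y = 0 := fun y => hist_eq_zero hu.2
    rw [sharpArray_D_zero, Finset.sum_pair (by decide)] at h0
    rw [sharpArray_D_one, Finset.sum_pair (by decide)] at h1
    have hj : (𝒜).jumpPart n (hist u.1 + hist u.2) = (𝒜).jumpPart n h := by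
      apply sharpArray_jumpPart_congr
      · simp [hz1 0 (by simp [sharpArray]), hz1 1 (by simp [sharpArray]), h0]
      · simp [hz0 2 (by simp [sharpArray]), hz0 3 (by simp [sharpArray]), h1]
    classical
    rw [Set.indicator_apply, Set.indicator_apply]
    refine if_congr ?_ rfl rfl
    change (Ψ (h 0 + h 1, h 2 + h 3) (hist u.1, hist u.2), (𝒜).jumpPart n h) ∈ S
      ↔ ((𝒜).gaussPart n (hist u.1 + hist u.2), (𝒜).jumpPart n (hist u.1 + hist u.2)) ∈ S
    rw [hj, hΨu]
  · have hz : (∏ i, ((𝒜).native n 0).real {u.1 i}) * ∏ i, ((𝒜).native n 1).real {u.2 i} = 0 := by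
      rw [not_and_or, not_forall, not_forall] at hu
      simp only [sharpArray_native_real_singleton hr]
      rcases hu with ⟨i, hi⟩ | ⟨i, hi⟩
      · rw [Finset.prod_eq_zero (Finset.mem_univ i) (sharpWeight_zero_eq_zero hi), zero_mul]
      · rw [Finset.prod_eq_zero (i := i) (Finset.mem_univ i) (sharpWeight_zero_eq_zero hi),
          mul_zero]
    rw [hz, zero_mul, zero_mul]

/-- The substitution replacing every message by a native draw from its block. -/
noncomputable def nativeHom (p : ℝ) : MvPolynomial (Fin 4) ℝ →ₐ[ℝ] MvPolynomial (Fin 4) ℝ :=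
  MvPolynomial.aeval ![lin (sharpWeight p p 0 0), lin (sharpWeight p p 0 0),
    lin (sharpWeight p p 0 1), lin (sharpWeight p p 0 1)]

theorem nativeHom_monomial (p : ℝ) (s : Fin 4 →₀ ℕ) :
    nativeHom p (MvPolynomial.monomial s 1)
      = lin (sharpWeight p p 0 0) ^ (s 0 + s 1) * lin (sharpWeight p p 0 1) ^ (s 2 + s 3) := by
  rw [nativeHom, MvPolynomial.aeval_monomial, Finsupp.prod_fintype _ _ (by simp),
    Fin.prod_univ_four]
  simp [pow_add, mul_assoc]

/-- Redrawing keeps only the block of a message, so `q` is forgotten and crossing users split like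
native ones. -/
theorem nativeHom_lin_sharpWeight (p q r : ℝ) (b : Fin 2) :
    nativeHom p (lin (sharpWeight p q r b)) = lin (sharpWeight p p r b) := by
  fin_cases b
  · simp only [Fin.zero_eta, lin_sharpWeight_zero]
    simp [nativeHom, lin_sharpWeight_zero]
    module
  · simp only [Fin.mk_one, lin_sharpWeight_one]
    simp [nativeHom, lin_sharpWeight_zero, lin_sharpWeight_one]
    module

theorem sharpWeight_zero_rate (p q : ℝ) (b : Fin 2) :
    sharpWeight p q 0 b = sharpWeight p p 0 b := by
  fin_cases b <;> simp [sharpWeight]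

/-- The auxiliary law is the law of the statistic when crossing users split like native ones. -/
theorem sharpArray_aux_real (hreg : (𝒜).InCriticalRegime) {n j : ℕ} (hj : j ≤ n)
    (hr : crossRate lam n < 1) {Ψ : ℕ × ℕ → (Fin 4 → ℕ) × (Fin 4 → ℕ) → (𝒜).M}
    (hΨ : (𝒜).AgreesOnBlocks n Ψ) {S : Set ((𝒜).M × (𝒜).Mᗮ)} (hS : MeasurableSet S) :
    (((((𝒜).T n j).map ((𝒜).jumpPart n)) ⊗ₘ (𝒜).factor n Ψ).map Prod.swap).real S
      = ev (((𝒜).stat n ⁻¹' S).indicator 1)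
        (lin (sharpWeight p q (crossRate lam n) 0) ^ (n - j)
          * lin (sharpWeight p p (crossRate lam n) 1) ^ j) := by
  have hD : Disjoint ((𝒜).D 0) ((𝒜).D 1) := by
    rw [sharpArray_D_zero, sharpArray_D_one]; decide
  have hS' : MeasurableSet (Prod.swap ⁻¹' S : Set ((𝒜).Mᗮ × (𝒜).M)) := measurable_swap hS
  have hfac : ∀ h : Fin 4 → ℕ, ((𝒜).factor n Ψ ((𝒜).jumpPart n h)).real
      (Prod.mk ((𝒜).jumpPart n h) ⁻¹' (Prod.swap ⁻¹' S)) = ev (((𝒜).stat n ⁻¹' S).indicator 1)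
        (lin (sharpWeight p q 0 0) ^ (h 0 + h 1) * lin (sharpWeight p q 0 1) ^ (h 2 + h 3)) := by
    intro h
    rw [← sharpArray_blocks_real hr hΨ hS h, ShuffleArray.factor, Kernel.comap_apply]
    simp only [(𝒜).total_jumpPart hreg hD]
    rw [sharpArray_D_zero, sharpArray_D_one, Finset.sum_pair (by decide),
      Finset.sum_pair (by decide)]
    rfl
  rw [measureReal_def, Measure.map_apply measurable_swap hS, Measure.compProd_apply hS',
    lintegral_map (Kernel.measurable_kernel_prodMk_left hS') Measurable.of_discrete,
    sharpArray_T_eq, lintegral_map Measurable.of_discrete Measurable.of_discrete,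
    lintegral_fintype, ENNReal.toReal_sum fun u _ => by finiteness]
  simp only [ENNReal.toReal_mul, ← measureReal_def, hfac, pi_real_singleton,
    sharpArray_W_real_singleton]
  -- Integrating the block kernel is a ring homomorphism on generating polynomials, because the
  -- redrawn messages are independent given the totals.
  have hhom : ∀ P, ev (fun h => ev (((𝒜).stat n ⁻¹' S).indicator 1)
        (lin (sharpWeight p q 0 0) ^ (h 0 + h 1) * lin (sharpWeight p q 0 1) ^ (h 2 + h 3))) P
      = ev (((𝒜).stat n ⁻¹' S).indicator 1) (nativeHom p P) := by
    intro P
    refine ev_linearMap (φ := ev (((𝒜).stat n ⁻¹' S).indicator 1) ∘ₗ (nativeHom p).toLinearMap)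
      (fun s => ?_) P
    simp only [LinearMap.comp_apply, AlgHom.toLinearMap_apply, nativeHom_monomial,
      sharpWeight_zero_rate p q]
  have hfin := hhom (lin (sharpWeight p q (crossRate lam n) 0) ^ (n - j)
          * lin (sharpWeight p q (crossRate lam n) 1) ^ j)
  rw [map_mul (nativeHom p), map_pow (nativeHom p), map_pow (nativeHom p),
    nativeHom_lin_sharpWeight, nativeHom_lin_sharpWeight,
    ← prod_lin_sharpWeight _ hj, ev_prod_lin] at hfin
  have h0 : sharpWeight p q (crossRate lam n) 0 = sharpWeight p p (crossRate lam n) 0 := rfl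
  rw [h0, ← hfin]
  exact Finset.sum_congr rfl fun u _ => mul_comm _ _

end sharp

section tv

variable {X : Type*} [MeasurableSpace X] {μ ν : Measure X}

theorem tv_nonneg : 0 ≤ tv μ ν := Real.iSup_nonneg fun _ => abs_nonneg _

theorem tv_le {c : ℝ} (hc : 0 ≤ c) (h : ∀ S, MeasurableSet S → |μ.real S - ν.real S| ≤ c) :
    tv μ ν ≤ c :=
  Real.iSup_le (fun S => h S.1 S.2) hc

theorem abs_sub_le_tv [IsFiniteMeasure μ] [IsFiniteMeasure ν] {S : Set X} (hS : MeasurableSet S) :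
    |μ.real S - ν.real S| ≤ tv μ ν := by
  refine le_ciSup (f := fun A : {A : Set X // MeasurableSet A} => |μ.real A.1 - ν.real A.1|)
    ⟨μ.real Set.univ + ν.real Set.univ, ?_⟩ ⟨S, hS⟩
  rintro _ ⟨A, rfl⟩
  have h1 : μ.real A.1 ≤ μ.real Set.univ := measureReal_mono (Set.subset_univ _)
  have h2 : ν.real A.1 ≤ ν.real Set.univ := measureReal_mono (Set.subset_univ _)
  refine (abs_sub _ _).trans ?_
  rw [abs_of_nonneg measureReal_nonneg, abs_of_nonneg measureReal_nonneg]
  exact add_le_add h1 h2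

end tv

instance {Y : Type*} [Fintype Y] [DecidableEq Y] [MeasurableSpace Y] (A : ShuffleArray Y)
    (n j : ℕ) : IsFiniteMeasure (A.T n j) := by
  unfold ShuffleArray.T ShuffleArray.shuffleLaw
  infer_instance

/-! ### Total variation bounds at fixed `n`, the critical regime, block centering -/

section sharp

variable {p q lam ratio : ℝ} {k : ℕ → ℕ} {hp : p ∈ Set.Icc (0 : ℝ) 1} {hq : q ∈ Set.Icc (0 : ℝ) 1}
  {hl : 0 ≤ lam}

local notation "𝒜" => sharpArray p q lam ratio k hp hq hl

theorem sharpArray_tv_le {n j : ℕ}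
    {Ψ : ℕ × ℕ → (Fin 4 → ℕ) × (Fin 4 → ℕ) → (𝒜).M}
    (hreg : (𝒜).InCriticalRegime) (hp' : p ∈ Set.Ioo (0 : ℝ) 1)
    (hj : j ≤ n) (hr : crossRate lam n < 1) (hΨ : (𝒜).AgreesOnBlocks n Ψ) :
    tv (((𝒜).T n j).map ((𝒜).stat n))
        (((((𝒜).T n j).map ((𝒜).jumpPart n)) ⊗ₘ (𝒜).factor n Ψ).map Prod.swap)
      ≤ j * (|crossRate lam n * (q - p)|
          * (Real.sqrt (((n - j : ℕ) + 1) * (p * (1 - p))))⁻¹) := by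
  refine tv_le (by positivity) fun S hS => ?_
  rw [sharpArray_map_stat_real hj hS, sharpArray_aux_real hreg hj hr hΨ hS, ← map_sub, ← mul_sub]
  refine massLE_sharpWeight_sub hp' hq (crossRate_mem hl n) _ _ _ fun h => ?_
  classical
  rw [Set.indicator_apply]
  split_ifs <;> simp

theorem sharpArray_le_tv {n j : ℕ}
    {Ψ : ℕ × ℕ → (Fin 4 → ℕ) × (Fin 4 → ℕ) → (𝒜).M}
    (hreg : (𝒜).InCriticalRegime) (hn : 0 < n)
    (hj : j ≤ n) (hr : crossRate lam n < 1) (hΨ : (𝒜).AgreesOnBlocks n Ψ) (K : ℕ) :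
    j * crossRate lam n * (1 - crossRate lam n) ^ (j - 1) * |p - q| * binom (n - j) p K
      ≤ tv (((𝒜).T n j).map ((𝒜).stat n))
        (((((𝒜).T n j).map ((𝒜).jumpPart n)) ⊗ₘ (𝒜).factor n Ψ).map Prod.swap) := by
  have hS : MeasurableSet ((𝒜).stat n '' crossEvent (n - j) K) :=
    ((crossEvent (n - j) K).to_countable.image _).measurableSet
  have h0 := (crossRate_mem hl n).1
  have h1 := sub_nonneg.2 (crossRate_mem hl n).2
  refine le_trans (le_of_eq ?_) (abs_sub_le_tv hS)
  rw [sharpArray_map_stat_real hj hS, sharpArray_aux_real hreg hj hr hΨ hS, ← map_sub, ← mul_sub,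
    Set.preimage_image_eq _ ((𝒜).stat_injective hn), ev_crossEvent_sharpWeight_sub, abs_mul,
    abs_mul, abs_of_nonneg (binom_nonneg hp _ _),
    abs_of_nonneg (show 0 ≤ j * crossRate lam n * (1 - crossRate lam n) ^ (j - 1) by positivity)]

theorem crossRate_eventually_eq (lam : ℝ) :
    ∀ᶠ n : ℕ in atTop, crossRate lam n = lam / n ∧ crossRate lam n < 1 := by
  filter_upwards [(tendsto_const_div_atTop_nhds_zero_nat lam).eventually_lt_const one_pos]
    with n hn
  have h : crossRate lam n = lam / n := min_eq_right hn.le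
  exact ⟨h, h ▸ hn⟩

theorem sharpArray_W_toReal (n : ℕ) (b : Fin 2) (y : Fin 4) :
    ((𝒜).W n b y).toReal = sharpWeight p q (crossRate lam n) b y :=
  ENNReal.toReal_ofReal (sharpWeight_nonneg hp hq (crossRate_mem hl n) b y)

theorem sharpArray_inCriticalRegime (hp' : p ∈ Set.Ioo (0 : ℝ) 1)
    (hk : ∀ n, 1 ≤ n → k n < n) (hkt : Tendsto (fun n : ℕ => (k n : ℝ) / n) atTop (𝓝 ratio)) :
    (𝒜).InCriticalRegime where
  dominant_nonempty b := by fin_cases b <;> simp [sharpArray]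
  p_pos b y hy := by
    have h0 := hp'.1
    have h1 := hp'.2
    fin_cases b <;> fin_cases y <;> simp_all [sharpArray]
  p_sum b := by fin_cases b <;> simp [sharpArray]
  α_nonneg b y hy := by
    have h0 := hq.1
    have h1 := sub_nonneg.2 hq.2
    fin_cases b <;> fin_cases y <;> simp [sharpArray] <;> positivity
  dominant b y hy := by
    have hO : ∀ c : ℝ, (fun n : ℕ => c * crossRate lam n) =O[atTop] fun n : ℕ => (n : ℝ)⁻¹ := by
      intro c
      refine IsBigO.of_bound (|c| * lam) ?_
      filter_upwards [crossRate_eventually_eq lam] with n hn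
      rw [hn.1, Real.norm_eq_abs, Real.norm_eq_abs, abs_mul, div_eq_mul_inv, abs_mul,
        abs_of_nonneg hl, mul_assoc]
    simp only [sharpArray_W_toReal]
    fin_cases b <;> fin_cases y <;> simp_all [sharpArray, sharpWeight] <;>
      first
        | exact isBigO_zero _ _
        | (refine (hO (-p)).congr_left fun n => ?_; ring1)
        | (refine (hO (-(1 - p))).congr_left fun n => ?_; ring1)
  rare b y hy := by
    have hT : ∀ c : ℝ, Tendsto (fun n : ℕ => (n : ℝ) * (crossRate lam n * c)) atTop
        (𝓝 (lam * c)) := by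
      intro c
      refine tendsto_const_nhds.congr' ?_
      filter_upwards [crossRate_eventually_eq lam, eventually_gt_atTop 0] with n hn hn0
      rw [hn.1]
      field_simp
    simp only [sharpArray_W_toReal]
    fin_cases b <;> fin_cases y <;> simp_all [sharpArray, sharpWeight]
  k_lt := hk
  k_tendsto := hkt

theorem sharpArray_twoDominantDisjoint : (𝒜).TwoDominantDisjoint := by
  refine ⟨fun b => ?_, by rw [sharpArray_D_zero, sharpArray_D_one]; decide⟩
  fin_cases b <;> simp [sharpArray]

theorem sharpArray_quantitative
    (h : ∃ C : ℝ, ∀ᶠ n : ℕ in atTop, |(k n : ℝ) / n - ratio| ≤ C / n) : (𝒜).Quantitative := by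
  obtain ⟨C, hC⟩ := h
  -- For `r = λ/n` the rare errors vanish; the dominant errors of input `1` are `pλ/n` and
  -- `(1-p)λ/n`, adding up to `λ/n`.
  refine ⟨lam + C, ?_⟩
  filter_upwards [hC, crossRate_eventually_eq lam, eventually_gt_atTop 0] with n hn hr hn0 b
  have hn0' : (0 : ℝ) < n := by exact_mod_cast hn0
  rw [add_div]
  refine add_le_add ?_ hn
  have hln : 0 ≤ lam / n := by positivity
  simp only [sharpArray_W_toReal, hr.1]
  have hc0 : ({0, 1} : Finset (Fin 4))ᶜ = {2, 3} := by decide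
  have hc1 : ({2, 3} : Finset (Fin 4))ᶜ = {0, 1} := by decide
  have h0 := hp.1
  have h1 := sub_nonneg.2 hp.2
  fin_cases b
  · simp [sharpArray, sharpWeight, hc0, hln]
  · have e1 : p * (1 - lam / n) - p = -(p * (lam / n)) := by ring
    have e2 : (1 - p) * (1 - lam / n) - (1 - p) = -((1 - p) * (lam / n)) := by ring
    have e3 : ∀ c : ℝ, (n : ℝ) * (lam / n * c) - lam * c = 0 := by
      intro c; field_simp; ring
    simp [sharpArray, sharpWeight, hc1, e1, e2, e3, abs_mul, abs_of_nonneg h0, abs_of_nonneg h1,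
      abs_of_nonneg hln]
    refine le_of_eq ?_
    ring

/-- Within a block, `⟨e_y - μ_b, μ_b⟩ = p_b(y) - ‖μ_b‖²`, which vanishes for the uniform split;
distinct blocks have disjoint supports. This is where `p = 1/2` enters. -/
theorem sharpArray_mean_mem_orthogonal (hp2 : p = 1 / 2) (b : Fin 2) :
    (𝒜).mean b ∈ (𝒜).Mᗮ := by
  have h : ∀ c, (𝒜).tangent c ≤ (Submodule.span ℝ {(𝒜).mean b})ᗮ := by
    intro c
    rw [ShuffleArray.tangent, Submodule.span_le]
    rintro _ ⟨y, hy, rfl⟩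
    rw [SetLike.mem_coe, Submodule.mem_orthogonal_singleton_iff_inner_right]
    subst hp2
    fin_cases b <;> fin_cases c <;> fin_cases y <;>
      simp_all [ShuffleArray.mean, ShuffleArray.e, sharpArray, PiLp.inner_apply,
        Fin.sum_univ_four] <;> norm_num
  rw [Submodule.mem_orthogonal']
  intro u hu
  exact Submodule.mem_orthogonal_singleton_iff_inner_right.1 (sup_le (h 0) (h 1) hu)

/-- The native block means are exactly `t_b μ_b`, so the two centerings differ by a combination of
`μ_0` and `μ_1`, which the projection on `M` kills. -/
theorem sharpArray_agreesOnBlocks_blockMap (hp2 : p = 1 / 2) {n : ℕ} (hr : crossRate lam n < 1) :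
    (𝒜).AgreesOnBlocks n ((𝒜).blockMap n) := by
  intro x h0 h1
  rw [ShuffleArray.blockMap, ShuffleArray.gaussPart]
  congr 1
  rw [← sub_eq_zero, ← map_sub, Submodule.orthogonalProjectionOnto_eq_zero_iff]
  set t : ℕ × ℕ := (∑ y ∈ (𝒜).D 0, x.1 y, ∑ y ∈ (𝒜).D 1, x.2 y) with ht
  simp only [sharpArray_native_real_singleton hr]
  have m0 := sharpArray_mean_mem_orthogonal (q := q) (lam := lam) (ratio := ratio) (k := k)
    (hp := hp) (hq := hq) (hl := hl) hp2 0
  have m1 := sharpArray_mean_mem_orthogonal (q := q) (lam := lam) (ratio := ratio) (k := k)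
    (hp := hp) (hq := hq) (hl := hl) hp2 1
  convert Submodule.add_mem _
    (Submodule.smul_mem _ ((𝒜).groupSize n 0 - t.1) m0)
    (Submodule.smul_mem _ ((𝒜).groupSize n 1 - t.2) m1) using 1
  have a0 := h1 0 (by simp [sharpArray])
  have a1 := h1 1 (by simp [sharpArray])
  have a2 := h0 2 (by simp [sharpArray])
  have a3 := h0 3 (by simp [sharpArray])
  ext y
  fin_cases y <;> simp [ShuffleArray.centered, ShuffleArray.mean, ShuffleArray.e,
    sharpWeight, sharpArray, a0, a1, a2, a3] <;> ring

end sharp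

/-! ### The exact order `n^{-1/2}` -/

section sharp

variable {p q lam ratio : ℝ} {k : ℕ → ℕ} {hp : p ∈ Set.Icc (0 : ℝ) 1} {hq : q ∈ Set.Icc (0 : ℝ) 1}
  {hl : 0 ≤ lam}

local notation "𝒜" => sharpArray p q lam ratio k hp hq hl

theorem sharpArray_tv_le_inv_sqrt
    {Ψ : ℕ × ℕ → (Fin 4 → ℕ) × (Fin 4 → ℕ) → (𝒜).M} {n j : ℕ} {δ : ℝ}
    (hreg : (𝒜).InCriticalRegime) (hp' : p ∈ Set.Ioo (0 : ℝ) 1) (hj : j ≤ n) (hn : 0 < n)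
    (hr : crossRate lam n = lam / n ∧ crossRate lam n < 1) (hΨ : (𝒜).AgreesOnBlocks n Ψ)
    (hδ : 0 < δ) (hjδ : δ * n ≤ (n - j : ℕ) + 1) :
    tv (((𝒜).T n j).map ((𝒜).stat n))
        (((((𝒜).T n j).map ((𝒜).jumpPart n)) ⊗ₘ (𝒜).factor n Ψ).map Prod.swap)
      ≤ lam * |q - p| * (Real.sqrt (δ * (p * (1 - p))))⁻¹ * (Real.sqrt n)⁻¹ := by
  have hn' : (0 : ℝ) < n := by exact_mod_cast hn
  have h0 := hp'.1
  have h1 : 0 < 1 - p := sub_pos.2 hp'.2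
  refine (sharpArray_tv_le hreg hp' hj hr.2 hΨ).trans ?_
  rw [hr.1, abs_mul, abs_of_nonneg (show 0 ≤ lam / n by positivity)]
  have hs : (Real.sqrt (((n - j : ℕ) + 1) * (p * (1 - p))))⁻¹
      ≤ (Real.sqrt (δ * (p * (1 - p))))⁻¹ * (Real.sqrt n)⁻¹ := by
    rw [← mul_inv, ← Real.sqrt_mul (by positivity), mul_right_comm]
    gcongr
  have hjn : (j : ℝ) * (lam / n) ≤ lam := by
    rw [← mul_div_assoc, div_le_iff₀ hn', mul_comm]
    gcongr
  calc (j : ℝ) * (lam / n * |q - p| * (Real.sqrt (((n - j : ℕ) + 1) * (p * (1 - p))))⁻¹)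
      = (j : ℝ) * (lam / n) * (|q - p| * (Real.sqrt (((n - j : ℕ) + 1) * (p * (1 - p))))⁻¹) := by
        ring
    _ ≤ lam * (|q - p| * ((Real.sqrt (δ * (p * (1 - p))))⁻¹ * (Real.sqrt n)⁻¹)) := by
        gcongr
    _ = _ := by ring

theorem sharpArray_comparisonError_isTheta
    {Ψ : ∀ _ : ℕ, ℕ × ℕ → (Fin 4 → ℕ) × (Fin 4 → ℕ) → (𝒜).M}
    (hreg : (𝒜).InCriticalRegime) (hp' : p ∈ Set.Ioo (0 : ℝ) 1) (hl' : 0 < lam) (hqp : q ≠ p)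
    (hratio : ratio ∈ Set.Ioo (0 : ℝ) 1) (hΨ : ∀ᶠ n in atTop, (𝒜).AgreesOnBlocks n (Ψ n)) :
    (𝒜).comparisonError Ψ =Θ[atTop] (fun n : ℕ => (n : ℝ) ^ (-(1 / 2) : ℝ)) := by
  have hrate : (fun n : ℕ => (n : ℝ) ^ (-(1 / 2) : ℝ)) = fun n : ℕ => (Real.sqrt n)⁻¹ := by
    funext n
    rw [Real.rpow_neg n.cast_nonneg, Real.sqrt_eq_rpow]
  rw [hrate]
  have hkt : Tendsto (fun n : ℕ => (k n : ℝ) / n) atTop (𝓝 ratio) := hreg.k_tendsto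
  have hexp : Tendsto (fun n : ℕ => (1 + -lam / n) ^ n) atTop (𝓝 (Real.exp (-lam))) :=
    Real.tendsto_one_add_div_pow_exp (-lam)
  have herr : ∀ n, 0 ≤ (𝒜).comparisonError Ψ n := fun n => add_nonneg tv_nonneg tv_nonneg
  -- Half the limiting proportion of zeros, so that eventually `n - k_n ≥ δ n`. The extra trial in
  -- the smoothing bound makes the same `δ` serve `j = k_n + 1`.
  set δ := (1 - ratio) / 2 with hδ
  have hδ0 : 0 < δ := by rw [hδ]; linarith [hratio.2]
  have hq0 : 0 < |p - q| := abs_pos.2 (sub_ne_zero.2 hqp.symm)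
  constructor
  · refine IsBigO.of_bound (2 * (lam * |q - p| * (Real.sqrt (δ * (p * (1 - p))))⁻¹)) ?_
    filter_upwards [hΨ, crossRate_eventually_eq lam, eventually_gt_atTop 0,
      hkt.eventually_lt_const (show ratio < 1 - δ by rw [hδ]; linarith [hratio.2])]
      with n hΨn hr hn hkn
    have hn' : (0 : ℝ) < n := by exact_mod_cast hn
    have hk : k n < n := hreg.k_lt n hn
    rw [div_lt_iff₀ hn'] at hkn
    rw [Real.norm_of_nonneg (herr n), Real.norm_of_nonneg (by positivity), two_mul, add_mul]
    refine add_le_add (sharpArray_tv_le_inv_sqrt hreg hp' hk.le hn hr hΨn hδ0 ?_)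
      (sharpArray_tv_le_inv_sqrt hreg hp' hk hn hr hΨn hδ0 ?_)
    · change δ * n ≤ ((n - k n : ℕ) : ℝ) + 1
      rw [Nat.cast_sub hk.le]
      linarith
    · change δ * n ≤ ((n - (k n + 1) : ℕ) : ℝ) + 1
      rw [Nat.cast_sub hk]
      push_cast
      linarith
  -- The null term alone suffices. The factors bound `k_n r` (limit `λπ`), the probability that the
  -- other `k_n - 1` ones do not cross, the gap between the splits, and the constant of the binomial
  -- mode.
  · set c := lam * (ratio / 2) * (Real.exp (-lam) / 2) * |p - q| * (5 : ℝ)⁻¹ with hc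
    have hr0 := hratio.1
    have hc0 : 0 < c := by positivity
    refine IsBigO.of_bound c⁻¹ ?_
    filter_upwards [hΨ, crossRate_eventually_eq lam, eventually_gt_atTop 0,
      hkt.eventually_const_lt (show ratio / 2 < ratio by linarith),
      hexp.eventually_const_lt (show Real.exp (-lam) / 2 < Real.exp (-lam) by
        linarith [Real.exp_pos (-lam)])] with n hΨn hr hn hkn hen
    have hn' : (0 : ℝ) < n := by exact_mod_cast hn
    have hk : k n < n := hreg.k_lt n hn
    rw [Real.norm_of_nonneg (herr n), Real.norm_of_nonneg (by positivity), ← div_eq_inv_mul,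
      le_div_iff₀' hc0]
    obtain ⟨K, hK⟩ := exists_le_binom hp (Nat.sub_pos_of_lt hk)
    have hrate0 := (crossRate_mem hl n).1
    have hrate1 : 0 ≤ 1 - crossRate lam n := by linarith [hr.2]
    have hlow := sharpArray_le_tv hreg hn hk.le hr.2 hΨn K
    refine le_trans ?_ (hlow.trans (le_add_of_nonneg_right tv_nonneg))
    have h1 : lam * (ratio / 2) ≤ k n * crossRate lam n := by
      rw [hr.1, mul_div_left_comm (k n : ℝ)]
      exact mul_le_mul_of_nonneg_left hkn.le hl
    -- Since `k_n - 1 ≤ n`, the power is at least `(1 - λ/n)^n`, which tends to `e^{-λ}`.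
    have h2 : Real.exp (-lam) / 2 ≤ (1 - crossRate lam n) ^ (k n - 1) := by
      refine hen.le.trans ?_
      rw [neg_div, ← sub_eq_add_neg, ← hr.1]
      exact pow_le_pow_of_le_one hrate1 (by linarith) (by omega)
    have h3 : (5 : ℝ)⁻¹ * (Real.sqrt n)⁻¹ ≤ binom (n - k n) p K := by
      refine le_trans ?_ hK
      rw [← mul_inv]
      have hpos : 0 < Real.sqrt ((n - k n : ℕ) : ℝ) :=
        Real.sqrt_pos.2 (by exact_mod_cast Nat.sub_pos_of_lt hk)
      gcongr
      omega
    calc c * (Real.sqrt n)⁻¹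
        = lam * (ratio / 2) * (Real.exp (-lam) / 2) * |p - q| * ((5 : ℝ)⁻¹ * (Real.sqrt n)⁻¹) := by
          rw [hc]; ring
      _ ≤ _ := by gcongr

end sharp

/-! ### The explicit witness and the conclusion -/

theorem not_isLittleO_of_isTheta_rpow {f : ℕ → ℝ} {a : ℝ}
    (h : f =Θ[atTop] fun n : ℕ => (n : ℝ) ^ a) : ¬ f =o[atTop] fun n : ℕ => (n : ℝ) ^ a := by
  intro ho
  have h1 := h.2.trans_isLittleO ho
  refine isLittleO_irrefl (Eventually.frequently ?_) h1
  filter_upwards [eventually_gt_atTop 0] with n hn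
  exact (Real.rpow_pos_of_pos (by exact_mod_cast hn) a).ne'

theorem abs_half_div_sub_half_le {n : ℕ} (hn : 0 < n) :
    |((n / 2 : ℕ) : ℝ) / n - 1 / 2| ≤ 1 / n := by
  have hn' : (0 : ℝ) < n := by exact_mod_cast hn
  have h1 : ((n / 2 : ℕ) : ℝ) / n - 1 / 2 = (((n / 2 : ℕ) : ℝ) - n / 2) / n := by
    field_simp
  rw [h1, abs_div, abs_of_pos hn']
  gcongr
  have h2 : 2 * ((n / 2 : ℕ) : ℝ) ≤ n := by exact_mod_cast Nat.mul_div_le n 2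
  have h3 : (n : ℝ) ≤ 2 * ((n / 2 : ℕ) : ℝ) + 1 := by
    have : n ≤ 2 * (n / 2) + 1 := by omega
    exact_mod_cast this
  rw [abs_le]
  constructor <;> linarith

end Shuffle

open Shuffle in
theorem mainTheorem4 :
    (∀ (p q lam ratio : ℝ) (k : ℕ → ℕ) (hp : p ∈ Set.Ioo (0 : ℝ) 1) (hq : q ∈ Set.Ioo (0 : ℝ) 1)
      (hl : 0 < lam), q ≠ p → ratio ∈ Set.Ioo (0 : ℝ) 1 → (∀ n, 1 ≤ n → k n < n) →
      Tendsto (fun n : ℕ => (k n : ℝ) / n) atTop (𝓝 ratio) →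
      let A := sharpArray p q lam ratio k (Set.Ioo_subset_Icc_self hp)
        (Set.Ioo_subset_Icc_self hq) hl.le
      A.InCriticalRegime ∧ A.TwoDominantDisjoint ∧ A.Interior ∧
      ((∃ C : ℝ, ∀ᶠ n : ℕ in atTop, |(k n : ℝ) / n - ratio| ≤ C / n) → A.Quantitative) ∧
      A.comparisonError A.statMap =Θ[atTop] (fun n : ℕ => (n : ℝ) ^ (-(1 / 2) : ℝ)) ∧
      (p = 1 / 2 →
        A.comparisonError A.blockMap =Θ[atTop] (fun n : ℕ => (n : ℝ) ^ (-(1 / 2) : ℝ)))) ∧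
    (∃ A : ShuffleArray (Fin 4),
      A.InCriticalRegime ∧ A.TwoDominantDisjoint ∧ A.Interior ∧ A.Quantitative ∧
      ¬ A.comparisonError A.statMap =o[atTop] (fun n : ℕ => (n : ℝ) ^ (-(1 / 2) : ℝ)) ∧
      ¬ A.comparisonError A.blockMap =o[atTop] (fun n : ℕ => (n : ℝ) ^ (-(1 / 2) : ℝ))) := by
  have main : ∀ (p q lam ratio : ℝ) (k : ℕ → ℕ) (hp : p ∈ Set.Ioo (0 : ℝ) 1)
      (hq : q ∈ Set.Ioo (0 : ℝ) 1) (hl : 0 < lam), q ≠ p → ratio ∈ Set.Ioo (0 : ℝ) 1 →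
      (∀ n, 1 ≤ n → k n < n) → Tendsto (fun n : ℕ => (k n : ℝ) / n) atTop (𝓝 ratio) →
      let A := sharpArray p q lam ratio k (Set.Ioo_subset_Icc_self hp)
        (Set.Ioo_subset_Icc_self hq) hl.le
      A.InCriticalRegime ∧ A.TwoDominantDisjoint ∧ A.Interior ∧
      ((∃ C : ℝ, ∀ᶠ n : ℕ in atTop, |(k n : ℝ) / n - ratio| ≤ C / n) → A.Quantitative) ∧
      A.comparisonError A.statMap =Θ[atTop] (fun n : ℕ => (n : ℝ) ^ (-(1 / 2) : ℝ)) ∧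
      (p = 1 / 2 →
        A.comparisonError A.blockMap =Θ[atTop] (fun n : ℕ => (n : ℝ) ^ (-(1 / 2) : ℝ))) := by
    intro p q lam ratio k hp hq hl hqp hratio hk hkt A
    have hreg : A.InCriticalRegime := sharpArray_inCriticalRegime hp hk hkt
    refine ⟨hreg, sharpArray_twoDominantDisjoint, hratio, sharpArray_quantitative,
      sharpArray_comparisonError_isTheta hreg hp hl hqp hratio
        (Eventually.of_forall fun n => A.agreesOnBlocks_statMap n), fun hp2 =>
      sharpArray_comparisonError_isTheta hreg hp hl hqp hratio ?_⟩
    filter_upwards [crossRate_eventually_eq lam] with n hn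
    exact sharpArray_agreesOnBlocks_blockMap hp2 hn.2
  refine ⟨main, ?_⟩
  have hlim : Tendsto (fun n : ℕ => ((n / 2 : ℕ) : ℝ) / n) atTop (𝓝 (1 / 2)) := by
    rw [tendsto_iff_norm_sub_tendsto_zero]
    refine squeeze_zero' (Eventually.of_forall fun n => norm_nonneg _) ?_
      tendsto_one_div_atTop_nhds_zero_nat
    filter_upwards [eventually_gt_atTop 0] with n hn
    exact abs_half_div_sub_half_le hn
  -- The choice `p = 1/2` makes one array serve both centerings; `q = 1/4` is any other split, and
  -- `k_n = ⌊n/2⌋` is within `1/n` of proportion `1/2`.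
  obtain ⟨h1, h2, h3, h4, h5, h6⟩ := main (1 / 2) (1 / 4) 1 (1 / 2) (fun n => n / 2)
    (by norm_num) (by norm_num) one_pos (by norm_num) (by norm_num)
    (fun n hn => Nat.div_lt_self hn one_lt_two) hlim
  refine ⟨_, h1, h2, h3, h4 ⟨1, ?_⟩, not_isLittleO_of_isTheta_rpow h5,
    not_isLittleO_of_isTheta_rpow (h6 rfl)⟩
  filter_upwards [eventually_gt_atTop 0] with n hn
  exact abs_half_div_sub_half_le hn
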